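/- Let $p$ be an odd prime, $m,\varsigma\ge 1$ integers, $q=p^m$, $n=4p^{\varsigma}$, and $F=\mathbb F_q$. For $\beta\in F^\times$ and $g\in F[x]$ identify the ideal $\langle g\rangle$ of $F[x]/\langle x^n-\beta\rangle$ with a linear code in $F^n$ through coefficients ($\beta$-constacyclic code); $C^\perp$ is the Euclidean dual. A linear $[n,k,d]_q$ code is *AMDS* if $d=n-k$. An $[[n,k,d]]_q$ quantum code is a $q^k$-dimensional subspace of $(\mathbb C^q)^{\otimes n}$ that detects every error acting on fewer than $d$ qudits but not every error acting on $d$ qudits; it is *qAMDS* if $2d=n-k$. For linear codes $C_2\subseteq C_1$ the CSS code is the span of the states $\sum_{y\in C_2}|x+y\rangle$, $x\in C_1$. Say that $C$ *yields* a qAMDS code of distance $d$ if $C$ is an AMDS $[n,n-d,d]_q$ code and, provided that $C^\perp\subseteq C$, the CSS code of $C^\perp\subseteq C$ is a qAMDS $[[n,n-2d,d]]_q$ code. All exponents $\iota,\jmath,\mu,\ell$ lie in $\{0,\dots,p^\varsigma\}$. (I) Let $\delta\in F$, $\delta^2=-1$, and $C_{\iota,\jmath,\mu,\ell}=\langle (x-1)^\iota(x+1)^\jmath(x-\delta)^\mu(x+\delta)^\ell\rangle$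 with $\beta=1$. Then $C_{\iota,\jmath,\mu,\ell}^\perp=C_{p^\varsigma-\iota,\,p^\varsigma-\jmath,\,p^\varsigma-\ell,\,p^\varsigma-\mu}$. The codes $C_{1,1,0,0}$ and $C_{2,0,0,0}$ yield qAMDS codes of distance $2$; $C_{1,1,0,0}$ contains its dual, and so does $C_{2,0,0,0}$ if $p^\varsigma\ge 4$. In all cases there is a qAMDS $[[4p^\varsigma,4p^\varsigma-4,2]]_{p^m}$ code. (II) Let $\delta$ be as in (I) and $\varsigma=1$. There is a qAMDS $[[4p^\varsigma,4p^\varsigma-4,2]]_{p^m}$ code. The code $C_{2,0,1,0}$ yields a qAMDS code of distance $3$, and it contains its dual if $p\ge 5$. In all cases there is a qAMDS $[[4p^\varsigma,4p^\varsigma-6,3]]_{p^m}$ code. (III) Let $C_{\iota,\jmath,\mu}=\langle (x-1)^\iota(x+1)^\jmath(x^2+1)^\mu\rangle$ with $\beta=1$. Then $C_{\iota,\jmath,\mu}^\perp=C_{p^\varsigma-\iota,\,p^\varsigma-\jmath,\,p^\varsigma-\mu}$. The codes $C_{1,1,0}$ and $C_{2,0,0}$ yield qAMDS codes of distance $2$;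 $C_{1,1,0}$ contains its dual, and so does $C_{2,0,0}$ if $p^\varsigma\ge 4$. In all cases there is a qAMDS $[[4p^\varsigma,4p^\varsigma-4,2]]_{p^m}$ code. (IV) There is a qAMDS $[[4p^\varsigma,4p^\varsigma-4,2]]_{p^m}$ code, and, if $\varsigma=1$, a qAMDS $[[4p^\varsigma,4p^\varsigma-6,3]]_{p^m}$ code. (V) Let $\phi\in F^\times$ and $C^{(\phi)}_{\iota,\jmath}=\langle (x^2-\phi)^\iota(x^2+\phi)^\jmath\rangle$ with $\beta=\phi^{2p^\varsigma}$. Then $(C^{(\phi)}_{\iota,\jmath})^\perp=C^{(\phi^{-1})}_{p^\varsigma-\iota,\,p^\varsigma-\jmath}$. The code $C^{(\phi)}_{1,0}$ yields a qAMDS code of distance $2$, and it contains its dual if $\phi^4=1$. In all cases there is a qAMDS $[[4p^\varsigma,4p^\varsigma-4,2]]_{p^m}$ code. (VI) Let $\gamma\in F$, $\gamma^2=-2$, $a\in F^\times$, $b=-a^2$, and let $C_{\iota,\mu}=\langle (x^2+\gamma a x+b)^\iota(x^2-\gamma a x+b)^\mu\rangle$ with $\beta=-b^{2p^\varsigma}$.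 Then $C_{\iota,\mu}^\perp$ is the $\beta^{-1}$-constacyclic code $\langle (x^2+\gamma a b^{-1}x+b^{-1})^{p^\varsigma-\iota}(x^2-\gamma a b^{-1}x+b^{-1})^{p^\varsigma-\mu}\rangle$. The code $C_{1,0}$ yields a qAMDS code of distance $2$, and it contains its dual if $b^4=1$. In all cases there are a qAMDS $[[4p^\varsigma,4p^\varsigma-4,2]]_{p^m}$ code and a quantum $[[4p^\varsigma,4p^\varsigma-2,2]]_{p^m}$ code. -/

import Mathlib

open Polynomial

noncomputable section

namespace QAMDS

/-! Classical linear codes of length `n` over a finite field `F`. -/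

/-- The polynomial `c₀ + c₁ x + ⋯ + c_{n-1} x^{n-1}` attached to the word `c`. -/
def wordPoly {F : Type*} [Field F] {n : ℕ} : (Fin n → F) →ₗ[F] F[X] where
  toFun c := ∑ i : Fin n, C (c i) * X ^ (i : ℕ)
  map_add' c c' := by simp [add_mul, Finset.sum_add_distrib]
  map_smul' a c := by simp [Polynomial.smul_eq_C_mul, Finset.mul_sum, mul_assoc]

/-- The `β`-constacyclic code of length `n` that is the ideal `⟨g⟩` of `F[x] / ⟨x ^ n - β⟩`,
seen as a set of words through their coefficients. -/
def constacyclicCode {F : Type*} [Field F] (n : ℕ) (β : F) (g : F[X]) :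
    Submodule F (Fin n → F) where
  carrier := {c | AdjoinRoot.mk (X ^ n - C β) (wordPoly c) ∈
    Ideal.span {AdjoinRoot.mk (X ^ n - C β) g}}
  add_mem' {c c'} hc hc' := by
    simp only [Set.mem_ofPred_eq, map_add] at *
    exact Ideal.add_mem _ hc hc'
  zero_mem' := by simp
  smul_mem' a c hc := by
    simp only [Set.mem_ofPred_eq, map_smul, Polynomial.smul_eq_C_mul, map_mul] at *
    exact Ideal.mul_mem_left _ _ hc

/-- The Euclidean dual of a linear code. -/
def dualCode {F : Type*} [Field F] {n : ℕ} (K : Submodule F (Fin n → F)) :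
    Submodule F (Fin n → F) where
  carrier := {a | ∀ b ∈ K, a ⬝ᵥ b = 0}
  add_mem' {a a'} ha ha' b hb := by rw [add_dotProduct, ha b hb, ha' b hb, add_zero]
  zero_mem' b _ := zero_dotProduct b
  smul_mem' t a ha b hb := by rw [smul_dotProduct, ha b hb, smul_zero]

open Classical in
/-- The minimum Hamming distance between distinct codewords (`0` for the zero code). -/
def minDist {F : Type*} [Field F] {n : ℕ} (K : Submodule F (Fin n → F)) : ℕ :=
  sInf {w | ∃ a ∈ K, ∃ b ∈ K, a ≠ b ∧ hammingDist a b = w}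

/-- `K` has parameters `[n, k, d]`. -/
def HasParams {F : Type*} [Field F] {n : ℕ} (K : Submodule F (Fin n → F)) (k d : ℕ) : Prop :=
  Module.finrank F K = k ∧ minDist K = d

/-- `K` is an almost MDS code with parameters `[n, k, d]`, that is, `d = n - k`. -/
def IsAMDS {F : Type*} [Field F] {n : ℕ} (K : Submodule F (Fin n → F)) (k d : ℕ) : Prop :=
  HasParams K k d ∧ k + d = n

/-! Quantum codes of length `n` over the alphabet `F`, with `q = |F|`. -/

/-- The space `(ℂ^q)^{⊗ n}`, with orthonormal basis the kets `|x⟩`, `x ∈ F ^ n`. -/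
abbrev StateSpace (F : Type*) (n : ℕ) : Type _ := EuclideanSpace ℂ (Fin n → F)

/-- The operator `E` acts only on the qudits in `S`: it has the form `A ⊗ 1`, where `A` is an
arbitrary operator on the qudits in `S`. -/
def ActsOn {F : Type*} {n : ℕ} (S : Finset (Fin n))
    (E : Matrix (Fin n → F) (Fin n → F) ℂ) : Prop :=
  ∃ A : Matrix (S → F) (S → F) ℂ, ∀ x y : Fin n → F,
    ((∀ i ∉ S, x i = y i) → E x y = A (fun i => x i) (fun i => y i)) ∧
    (¬ (∀ i ∉ S, x i = y i) → E x y = 0)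

open Classical in
/-- `Q` detects the error `E`: `P E P = t P` for a scalar `t`, with `P` the orthogonal projection
onto `Q`. -/
def Detects {F : Type*} [Fintype F] {n : ℕ} (Q : Submodule ℂ (StateSpace F n))
    (E : Matrix (Fin n → F) (Fin n → F) ℂ) : Prop :=
  ∃ t : ℂ, ∀ u ∈ Q, ∀ v ∈ Q, inner ℂ u (Matrix.toEuclideanLin E v) = t * inner ℂ u v

/-- `Q` is a quantum code with parameters `[[n, k, d]]_q`: it has dimension `q ^ k`, it detects
every error that acts on fewer than `d` qudits, and not every error that acts on `d` qudits. -/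
def IsQuantumCode {F : Type*} [Fintype F] {n : ℕ} (Q : Submodule ℂ (StateSpace F n))
    (k d : ℕ) : Prop :=
  Module.finrank ℂ Q = Fintype.card F ^ k ∧
  (∀ S : Finset (Fin n), S.card < d → ∀ E, ActsOn S E → Detects Q E) ∧
  (∃ S : Finset (Fin n), S.card = d ∧ ∃ E, ActsOn S E ∧ ¬ Detects Q E)

/-- `Q` is a quantum almost MDS code with parameters `[[n, k, d]]_q`, that is, `2 d = n - k`. -/
def IsQAMDS {F : Type*} [Fintype F] {n : ℕ} (Q : Submodule ℂ (StateSpace F n))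
    (k d : ℕ) : Prop :=
  IsQuantumCode Q k d ∧ k + 2 * d = n

/-- The quantum code given by the CSS construction from linear codes `K₂ ⊆ K₁`: the span of the
coset states `∑_{y ∈ K₂} |x + y⟩` with `x ∈ K₁`, that is, the set of the states that are supported
on `K₁` and invariant under translation by `K₂`. -/
def cssCode {F : Type*} [Field F] [Fintype F] {n : ℕ} (K₁ K₂ : Submodule F (Fin n → F)) :
    Submodule ℂ (StateSpace F n) where
  carrier := {f | (∀ x ∉ K₁, f x = 0) ∧ ∀ x, ∀ y ∈ K₂, f (x + y) = f x}
  add_mem' {f g} hf hg := by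
    refine ⟨fun x hx => ?_, fun x y hy => ?_⟩
    · simp [hf.1 x hx, hg.1 x hx]
    · simp [hf.2 x y hy, hg.2 x y hy]
  zero_mem' := by simp
  smul_mem' t f hf := by
    refine ⟨fun x hx => ?_, fun x y hy => ?_⟩
    · simp [hf.1 x hx]
    · simp [hf.2 x y hy]

/-- `K` is an AMDS code `[n, n - d, d]`, and as soon as it contains its dual, the CSS construction
turns it into a quantum AMDS code `[[n, n - 2 d, d]]`. -/
def YieldsQAMDS {F : Type*} [Field F] [Fintype F] {n : ℕ} (K : Submodule F (Fin n → F))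
    (d : ℕ) : Prop :=
  IsAMDS K (n - d) d ∧ (dualCode K ≤ K → IsQAMDS (cssCode K (dualCode K)) (n - 2 * d) d)

/-! The families of constacyclic codes of length `4 N`, to be used with `N = p ^ s`, where `p` is
the characteristic of `F`. -/

/-- The cyclic code `⟨(x - 1)^i (x + 1)^j (x - δ)^k (x + δ)^l⟩`, where `δ² = -1`. -/
def codeLin {F : Type*} [Field F] (N : ℕ) (δ : F) (i j k l : ℕ) :
    Submodule F (Fin (4 * N) → F) :=
  constacyclicCode (4 * N) 1 ((X - 1) ^ i * (X + 1) ^ j * (X - C δ) ^ k * (X + C δ) ^ l)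

/-- The cyclic code `⟨(x - 1)^i (x + 1)^j (x² + 1)^k⟩`. -/
def codeMixed (F : Type*) [Field F] (N : ℕ) (i j k : ℕ) : Submodule F (Fin (4 * N) → F) :=
  constacyclicCode (4 * N) 1 ((X - 1) ^ i * (X + 1) ^ j * (X ^ 2 + 1) ^ k)

/-- The code `⟨(x² - φ)^i (x² + φ)^j⟩` in `F[x] / ⟨(x⁴ - φ²)^N⟩`, where
`(x⁴ - φ²)^N = x^{4N} - φ^{2N}` for `N` a power of the characteristic. -/
def codeQuad {F : Type*} [Field F] (N : ℕ) (φ : F) (i j : ℕ) : Submodule F (Fin (4 * N) → F) :=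
  constacyclicCode (4 * N) (φ ^ (2 * N)) ((X ^ 2 - C φ) ^ i * (X ^ 2 + C φ) ^ j)

/-- The code `⟨(x² + c x + b)^i (x² - c x + b)^j⟩` in `F[x] / ⟨(x⁴ + b²)^N⟩`, where
`c² = 2 b`, so that `(x² + c x + b) (x² - c x + b) = x⁴ + b²`, and
`(x⁴ + b²)^N = x^{4N} + b^{2N}` for `N` a power of the odd characteristic. -/
def codeTrinom {F : Type*} [Field F] (N : ℕ) (c b : F) (i j : ℕ) :
    Submodule F (Fin (4 * N) → F) :=
  constacyclicCode (4 * N) (-b ^ (2 * N))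
    ((X ^ 2 + C c * X + C b) ^ i * (X ^ 2 - C c * X + C b) ^ j)

end QAMDS

end

open Polynomial

noncomputable section

namespace QAMDS

/-! ### Duals of linear codes under the dot product -/

section Dual

variable {F : Type*} [Field F] {n : ℕ}

/-! Quantum distances come from the CSS construction. The CSS code of K₂ ⊆ K₁ detects every error on
a set S of qudits if neither K₁ nor K₂^⊥ has a nonzero word supported on S (`detects_cssCode`),
while the translation by a word of K₁ outside K₂ is never detected (`exists_not_detects_cssCode`).
For K₂ = K₁^⊥ the distance is thus the minimum weight of K₁, provided that a lightest word lies
outside K₁^⊥.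

For the constacyclic codes, Frobenius makes x^{4p^s} - β the p^s-th power of a quartic, which is
then factored by hand. The dual of ⟨g⟩ is generated by the reciprocal of (x^n - β)/g
(`dualCode_constacyclicCode`), because reversing one word turns a dot product into a coefficient of
a product of polynomials. Duals are therefore found by inverting roots, and dual containment is a
divisibility. A nonconstant g prime to x has no multiple of weight one, and a binomial multiple has
weight two. A sparse multiple f of g with deg f + deg g < n lies outside the dual
(`coeff_notMem_dualCode`). For ⟨(x-1)²(x-δ)⟩ with s = 1, the check columns (1, k, δ^k) determine k
modulo p and modulo 4, so any two are independent and the distance is at least three; the trinomial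
(x⁴-1)² attains it.

The codes claimed in all cases need no hypothesis on the family. In distance two, ⟨x²-1⟩ always
contains its dual. In distance three and length 4p, the code need not be constacyclic: two families
of 4p distinct points of a projective plane, orthogonal as check matrices, suffice
(`exists_isQAMDS_three`). For p ≥ 5 a p × 4 grid, used twice, works; for p = 3 an explicit pair is
checked modulo 3. -/

theorem mem_dualCode {K : Submodule F (Fin n → F)} {a : Fin n → F} :
    a ∈ dualCode K ↔ ∀ b ∈ K, a ⬝ᵥ b = 0 := Iff.rfl

theorem dualCode_eq_orthogonal (K : Submodule F (Fin n → F)) :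
    dualCode K = LinearMap.BilinForm.orthogonal (dotProductBilin F F) K := by
  ext a
  simp only [mem_dualCode, LinearMap.BilinForm.mem_orthogonal_iff]
  exact forall₂_congr fun b _ => by simp [dotProduct_comm a b]

theorem nondegenerate_dotProductBilin :
    (dotProductBilin F F : LinearMap.BilinForm F (Fin n → F)).Nondegenerate := by
  constructor
  · intro a ha
    exact dotProduct_eq_zero a ha
  · intro a ha
    refine dotProduct_eq_zero a fun b => ?_
    rw [dotProduct_comm]
    exact ha b

theorem isRefl_dotProductBilin :
    LinearMap.BilinForm.IsRefl (dotProductBilin F F : LinearMap.BilinForm F (Fin n → F)) := by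
  intro a b h
  rw [dotProductBilin_apply_apply] at h ⊢
  rwa [dotProduct_comm]

theorem finrank_add_finrank_dualCode (K : Submodule F (Fin n → F)) :
    Module.finrank F K + Module.finrank F (dualCode K) = n := by
  rw [dualCode_eq_orthogonal,
    LinearMap.BilinForm.finrank_orthogonal nondegenerate_dotProductBilin]
  have := K.finrank_le
  simp only [Module.finrank_fintype_fun_eq_card, Fintype.card_fin] at this ⊢
  omega

theorem dualCode_dualCode (K : Submodule F (Fin n → F)) : dualCode (dualCode K) = K := by
  rw [dualCode_eq_orthogonal, dualCode_eq_orthogonal,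
    LinearMap.BilinForm.orthogonal_orthogonal nondegenerate_dotProductBilin
      isRefl_dotProductBilin]

/-- If the dual code has no nonzero word supported on `S`, the code restricts onto `F ^ S`. -/
theorem exists_mem_restrict_eq (K : Submodule F (Fin n → F)) (S : Finset (Fin n))
    (hS : ∀ w ∈ dualCode K, (∀ i ∉ S, w i = 0) → w = 0) (z : S → F) :
    ∃ y ∈ K, ∀ i : S, y i = z i := by
  classical
  let L : (Fin n → F) →ₗ[F] (S → F) := LinearMap.funLeft F F (fun i : S => (i : Fin n))
  suffices h : K.map L = ⊤ by
    obtain ⟨y, hy, hyz⟩ := (h ▸ Submodule.mem_top : z ∈ K.map L)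
    exact ⟨y, hy, fun i => congrFun hyz i⟩
  by_contra hne
  obtain ⟨f, hf0, hf⟩ := Submodule.exists_le_ker_of_lt_top _ (lt_top_iff_ne_top.2 hne)
  refine hf0 (LinearMap.pi_ext' fun i => LinearMap.ext_ring ?_)
  -- A functional killing the restriction of `K` to `S`, extended by zero, is a dual word supported
  -- on `S`.
  let w : Fin n → F := fun k => if h : k ∈ S then f (Pi.single ⟨k, h⟩ 1) else 0
  have hw : w = 0 := by
    refine hS w (fun b hb => ?_) fun k hk => by simp [w, hk]
    have hb' : f (L b) = 0 := hf (Submodule.mem_map_of_mem hb)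
    rw [LinearMap.pi_apply_eq_sum_univ f] at hb'
    rw [← hb', dotProduct, ← Finset.sum_subset (Finset.subset_univ S)
      (fun k _ hk => by simp [w, hk]), ← Finset.sum_coe_sort S]
    refine Finset.sum_congr rfl fun k _ => ?_
    have : (fun j : S => if k = j then (1 : F) else 0) = Pi.single k 1 := by
      ext j; simp [Pi.single_apply, eq_comm]
    simp [w, L, this, mul_comm, LinearMap.funLeft_apply]
  have := congrFun hw i
  simpa [w] using this

end Dual

/-! ### Minimum distance and Hamming weight -/

section Weight

variable {F : Type*} [Field F] {n : ℕ}

open Classical in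
theorem minDist_eq {K : Submodule F (Fin n → F)} {d : ℕ}
    (hd : ∀ w ∈ K, w ≠ 0 → d ≤ hammingNorm w)
    {w : Fin n → F} (hwK : w ∈ K) (hw0 : w ≠ 0) (hw : hammingNorm w = d) : minDist K = d := by
  apply le_antisymm
  · refine Nat.sInf_le ⟨w, hwK, 0, K.zero_mem, hw0, ?_⟩
    rw [hammingDist_zero_right]
    convert hw
  · refine le_csInf ⟨_, w, hwK, 0, K.zero_mem, hw0, rfl⟩ ?_
    rintro _ ⟨a, ha, b, hb, hab, rfl⟩
    rw [hammingDist_eq_hammingNorm]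
    exact hd _ (K.add_mem (K.neg_mem ha) hb) fun h => hab (by rwa [neg_add_eq_zero] at h)

open Classical in
theorem hammingNorm_le_card_of_forall_notMem {w : Fin n → F} {S : Finset (Fin n)}
    (h : ∀ i ∉ S, w i = 0) : hammingNorm w ≤ S.card := by
  refine Finset.card_le_card fun i hi => ?_
  by_contra hiS
  exact (Finset.mem_filter.1 hi).2 (h i hiS)

end Weight

/-! ### The CSS construction: dimension, detected and undetected errors -/

section CSS

variable {F : Type*} [Field F] [Fintype F] {n : ℕ}

theorem mem_cssCode {K₁ K₂ : Submodule F (Fin n → F)} {f : StateSpace F n} :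
    f ∈ cssCode K₁ K₂ ↔ (∀ x ∉ K₁, f x = 0) ∧ ∀ x, ∀ y ∈ K₂, f (x + y) = f x := Iff.rfl

open Classical in
/-- States of the CSS code are functions on the quotient `K₁ / K₂`. -/
def cssCodeEquiv (K₁ K₂ : Submodule F (Fin n → F)) (h : K₂ ≤ K₁) :
    cssCode K₁ K₂ ≃ₗ[ℂ] ((K₁ ⧸ K₂.submoduleOf K₁) → ℂ) where
  toFun f c := f.1 (Quotient.out c : K₁)
  map_add' f g := by ext; simp
  map_smul' t f := by ext; simp
  invFun φ := ⟨WithLp.toLp 2 fun x => if hx : x ∈ K₁ then φ (Submodule.Quotient.mk ⟨x, hx⟩) else 0, by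
    refine mem_cssCode.2 ⟨fun x hx => by simp [hx], fun x y hy => ?_⟩
    have hiff : x + y ∈ K₁ ↔ x ∈ K₁ := K₁.add_mem_iff_left (h hy)
    by_cases hx : x ∈ K₁
    · simp only [hiff.2 hx, hx, dite_true]
      congr 1
      rw [Submodule.Quotient.eq]
      simpa [Submodule.submoduleOf] using hy
    · simp [hx, hiff]⟩
  left_inv f := by
    ext x
    by_cases hx : x ∈ K₁
    · simp only [hx, dite_true]
      have hq : Submodule.Quotient.mk (Quotient.out
          (Submodule.Quotient.mk (p := K₂.submoduleOf K₁) ⟨x, hx⟩)) =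
          Submodule.Quotient.mk (p := K₂.submoduleOf K₁) ⟨x, hx⟩ := Quotient.out_eq _
      rw [Submodule.Quotient.eq] at hq
      have := f.2.2 x _ (show _ ∈ K₂ from hq)
      simpa using this
    · simp [hx, f.2.1 x hx]
  right_inv φ := by
    ext c
    simp only [SetLike.coe_mem, dite_true]
    congr 1
    exact Quotient.out_eq c

theorem finrank_cssCode {K₁ K₂ : Submodule F (Fin n → F)} (h : K₂ ≤ K₁) {k : ℕ}
    (hk : Module.finrank F K₁ = Module.finrank F K₂ + k) :
    Module.finrank ℂ (cssCode K₁ K₂) = Fintype.card F ^ k := by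
  classical
  have : Fintype (K₁ ⧸ K₂.submoduleOf K₁) := Fintype.ofFinite _
  rw [(cssCodeEquiv K₁ K₂ h).finrank_eq, Module.finrank_fintype_fun_eq_card,
    Module.card_eq_pow_finrank (K := F)]
  congr 1
  have h1 := (K₂.submoduleOf K₁).finrank_quotient_add_finrank
  rw [(Submodule.submoduleOfEquivOfLe h).finrank_eq] at h1
  omega

open Classical in
theorem inner_toEuclideanLin {F : Type*} [Fintype F] (E : Matrix (Fin n → F) (Fin n → F) ℂ) (u v : StateSpace F n) :
    inner ℂ u (Matrix.toEuclideanLin E v) =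
      ∑ x, ∑ y, E x y * (starRingEnd ℂ (u x) * v y) := by
  simp only [PiLp.inner_apply, RCLike.inner_apply, Matrix.toLpLin_apply, Matrix.mulVec, dotProduct,
    Finset.sum_mul]
  exact Finset.sum_congr rfl fun x _ => Finset.sum_congr rfl fun y _ => by ring

-- Some word of `K` agrees with `x` on `S`, so translating the summation index by that word absorbs
-- `x`.
open Classical in
theorem sum_restrict_add_eq {K : Submodule F (Fin n → F)} {S : Finset (Fin n)}
    (hS : ∀ w ∈ dualCode K, (∀ i ∉ S, w i = 0) → w = 0) (a : (S → F) → ℂ) (x : Fin n → F) :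
    ∑ y : K, a (fun i => (x + y) i) = ∑ y : K, a (fun i => (y : Fin n → F) i) := by
  obtain ⟨y₀, hy₀, h⟩ := exists_mem_restrict_eq K S hS (fun i => x i)
  refine Fintype.sum_equiv (Equiv.addLeft (⟨y₀, hy₀⟩ : K)) _ _ fun y => ?_
  congr 1
  ext i
  simp [h i]

-- Two words of `K₁` that agree off `S` coincide by `h₁`, so only the diagonal of `E` matters. The
-- states are invariant under `K₂`, so each diagonal entry may be averaged over a coset of `K₂`; by
-- `h₂` the code `K₂` restricts onto all of F^S, so the average is the same for every coset.
open Classical in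
theorem detects_cssCode {K₁ K₂ : Submodule F (Fin n → F)} {S : Finset (Fin n)}
    (h₁ : ∀ w ∈ K₁, (∀ i ∉ S, w i = 0) → w = 0)
    (h₂ : ∀ w ∈ dualCode K₂, (∀ i ∉ S, w i = 0) → w = 0)
    {E : Matrix (Fin n → F) (Fin n → F) ℂ} (hE : ActsOn S E) : Detects (cssCode K₁ K₂) E := by
  obtain ⟨A, hA⟩ := hE
  let a : (S → F) → ℂ := fun z => A z z
  -- The scalar is the mean of the diagonal of `A` over the restrictions of words of `K₂`.
  refine ⟨(∑ y : K₂, a (fun i => (y : Fin n → F) i)) / Fintype.card K₂, fun u hu v hv => ?_⟩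
  have hdiag : inner ℂ u (Matrix.toEuclideanLin E v) =
      ∑ x, a (fun i => x i) * (starRingEnd ℂ (u x) * v x) := by
    rw [inner_toEuclideanLin]
    refine Finset.sum_congr rfl fun x _ => ?_
    rw [Finset.sum_eq_single x]
    · rw [(hA x x).1 fun _ _ => rfl]
    · intro y _ hyx
      by_cases hx : x ∈ K₁
      · by_cases hy : y ∈ K₁
        · rw [(hA x y).2, zero_mul]
          intro hxy
          have := h₁ _ (K₁.sub_mem hx hy) fun i hi => by simp [hxy i hi]
          exact hyx (sub_eq_zero.1 this).symm
        · simp [hv.1 y hy]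
      · simp [hu.1 x hx]
    · simp
  have hshift : ∀ y : K₂, ∑ x, a (fun i => x i) * (starRingEnd ℂ (u x) * v x) =
      ∑ x : Fin n → F, a (fun i => (x + (y : Fin n → F)) i) * (starRingEnd ℂ (u x) * v x) := fun y => by
    rw [← Equiv.sum_comp (Equiv.addRight (y : Fin n → F))]
    refine Finset.sum_congr rfl fun x _ => ?_
    simp only [Equiv.coe_addRight]
    rw [hu.2 x y y.2, hv.2 x y y.2]
  have hcard : (Fintype.card K₂ : ℂ) ≠ 0 := Nat.cast_ne_zero.2 Fintype.card_ne_zero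
  rw [hdiag, div_mul_eq_mul_div, eq_div_iff hcard, mul_comm, ← nsmul_eq_mul, ← Finset.card_univ,
    ← Finset.sum_const, Finset.sum_congr rfl fun y _ => hshift y, Finset.sum_comm,
    PiLp.inner_apply, Finset.mul_sum]
  refine Finset.sum_congr rfl fun x _ => ?_
  rw [← Finset.sum_mul, sum_restrict_add_eq h₂, RCLike.inner_apply, mul_comm (v x)]

open Classical in
/-- The state `∑_{y ∈ K} |x + y⟩`. -/
def cosetState (K : Submodule F (Fin n → F)) (x : Fin n → F) : StateSpace F n :=
  WithLp.toLp 2 fun z => if z - x ∈ K then 1 else 0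

theorem cosetState_mem_cssCode {K₁ K₂ : Submodule F (Fin n → F)} (h : K₂ ≤ K₁) {x : Fin n → F}
    (hx : x ∈ K₁) : cosetState K₂ x ∈ cssCode K₁ K₂ := by
  classical
  refine mem_cssCode.2 ⟨fun z hz => ?_, fun z y hy => ?_⟩
  · have : z - x ∉ K₂ := fun hzx => hz (by simpa using K₁.add_mem (h hzx) hx)
    simp [cosetState, this]
  · have : z + y - x ∈ K₂ ↔ z - x ∈ K₂ := by
      rw [add_sub_right_comm]; exact K₂.add_mem_iff_left hy
    simp [cosetState, this]

open Classical in
theorem exists_not_detects_cssCode {K₁ K₂ : Submodule F (Fin n → F)} (h : K₂ ≤ K₁)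
    {w : Fin n → F} (hw₁ : w ∈ K₁) (hw₂ : w ∉ K₂) :
    ∃ E, ActsOn (Finset.univ.filter fun i => w i ≠ 0) E ∧ ¬ Detects (cssCode K₁ K₂) E := by
  -- The error is the translation by `w`. It carries the coset state of 0 to that of `w`, which is
  -- orthogonal to it since `w` is not in `K₂`: a zero inner product becomes the nonzero number
  -- |K₂|.
  refine ⟨Matrix.of fun x y => if x = y + w then 1 else 0,
    ⟨Matrix.of fun α β => if ∀ i, α i = β i + w i then 1 else 0, fun x y => ⟨fun hxy => ?_, fun hxy => ?_⟩⟩,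
    ?_⟩
  · refine if_congr ⟨fun e i => by simp [e], fun e => funext fun i => ?_⟩ rfl rfl
    by_cases hi : w i = 0
    · simpa [hi] using hxy i (by simp [hi])
    · exact e ⟨i, by simp [hi]⟩
  · refine if_neg fun e => hxy fun i hi => ?_
    have : w i = 0 := by simpa using hi
    simp [e, this]
  · rintro ⟨t, ht⟩
    have := ht _ (cosetState_mem_cssCode h hw₁) _ (cosetState_mem_cssCode h K₁.zero_mem)
    have horth : inner ℂ (cosetState K₂ w) (cosetState K₂ 0) = (0 : ℂ) := by
      rw [PiLp.inner_apply]
      refine Finset.sum_eq_zero fun x _ => ?_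
      by_cases hx : x ∈ K₂
      · have : x - w ∉ K₂ := fun hxw => hw₂ (by simpa using K₂.sub_mem hx hxw)
        simp [cosetState, this]
      · simp [cosetState, hx]
    rw [horth, mul_zero, inner_toEuclideanLin, Finset.sum_comm] at this
    have hsum : ∀ y : Fin n → F, ∑ x, Matrix.of (fun x y => if x = y + w then (1 : ℂ) else 0) x y *
        (starRingEnd ℂ (cosetState K₂ w x) * cosetState K₂ 0 y) = if y ∈ K₂ then 1 else 0 := by
      intro y
      rw [Finset.sum_eq_single (y + w) (fun x _ hx => by simp [hx]) (by simp)]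
      by_cases hy : y ∈ K₂ <;> simp [cosetState, hy]
    rw [Finset.sum_congr rfl fun y _ => hsum y, Finset.sum_boole, Nat.cast_eq_zero,
      Finset.card_eq_zero] at this
    have h0 : (0 : Fin n → F) ∈ Finset.univ.filter (· ∈ K₂) := by simp
    simp [this] at h0

open Classical in
/-- The CSS construction. -/
theorem isQuantumCode_cssCode {K₁ K₂ : Submodule F (Fin n → F)} (h : K₂ ≤ K₁) {k d : ℕ}
    (hk : Module.finrank F K₁ = Module.finrank F K₂ + k)
    (h₁ : ∀ w ∈ K₁, w ≠ 0 → d ≤ hammingNorm w)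
    (h₂ : ∀ w ∈ dualCode K₂, w ≠ 0 → d ≤ hammingNorm w)
    {w : Fin n → F} (hw₁ : w ∈ K₁) (hw₂ : w ∉ K₂) (hw : hammingNorm w = d) :
    IsQuantumCode (cssCode K₁ K₂) k d := by
  refine ⟨finrank_cssCode h hk, fun S hS E hE => detects_cssCode ?_ ?_ hE,
    _, hw, exists_not_detects_cssCode h hw₁ hw₂⟩
  · intro w hw hwS
    by_contra hw0
    have := (h₁ w hw hw0).trans (hammingNorm_le_card_of_forall_notMem hwS)
    omega
  · intro w hw hwS
    by_contra hw0
    have := (h₂ w hw hw0).trans (hammingNorm_le_card_of_forall_notMem hwS)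
    omega

end CSS

/-! ### Constacyclic codes: dimension, dual, weights of sparse multiples -/

section Constacyclic

variable {F : Type*} [Field F] {n : ℕ}

theorem wordPoly_apply (c : Fin n → F) :
    wordPoly c = ∑ i : Fin n, C (c i) * X ^ (i : ℕ) := rfl

theorem coeff_wordPoly (c : Fin n → F) (i : Fin n) : (wordPoly c).coeff i = c i := by
  rw [wordPoly_apply, finsetSum_coeff, Finset.sum_eq_single i]
  · simp
  · intro j _ hj
    rw [coeff_C_mul_X_pow, if_neg fun h => hj (Fin.ext h.symm)]
  · simp

theorem degree_wordPoly_lt (c : Fin n → F) : (wordPoly c).degree < n := by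
  rw [wordPoly_apply]
  refine degree_sum_fin_lt c

theorem wordPoly_coeff {f : F[X]} (hf : f.degree < n) :
    wordPoly (fun i : Fin n => f.coeff i) = f := by
  ext k
  by_cases hk : k < n
  · exact coeff_wordPoly _ (⟨k, hk⟩ : Fin n)
  · have hk' : (n : WithBot ℕ) ≤ k := by exact_mod_cast not_lt.1 hk
    rw [coeff_eq_zero_of_degree_lt ((degree_wordPoly_lt _).trans_le hk'),
      coeff_eq_zero_of_degree_lt (hf.trans_le hk')]

theorem wordPoly_eq_zero_iff {c : Fin n → F} : wordPoly c = 0 ↔ c = 0 := by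
  refine ⟨fun h => funext fun i => ?_, fun h => by simp [h]⟩
  rw [← coeff_wordPoly c i, h, coeff_zero, Pi.zero_apply]

theorem natDegree_wordPoly_lt {c : Fin n → F} (hc : c ≠ 0) : (wordPoly c).natDegree < n :=
  (natDegree_lt_iff_degree_lt (mt wordPoly_eq_zero_iff.1 hc)).2 (degree_wordPoly_lt c)

theorem mem_constacyclicCode {β : F} {g : F[X]} (hg : g ∣ X ^ n - C β) {c : Fin n → F} :
    c ∈ constacyclicCode n β g ↔ g ∣ wordPoly c := by
  change AdjoinRoot.mk (X ^ n - C β) (wordPoly c) ∈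
    Ideal.span {AdjoinRoot.mk (X ^ n - C β) g} ↔ _
  rw [Ideal.mem_span_singleton]
  constructor
  · rintro ⟨r, hr⟩
    obtain ⟨r, rfl⟩ := AdjoinRoot.mk_surjective r
    rw [← map_mul, AdjoinRoot.mk_eq_mk] at hr
    exact (dvd_sub_left (dvd_mul_right g r)).1 (hg.trans hr)
  · exact fun h => map_dvd _ h

theorem constacyclicCode_le {β : F} {g g' : F[X]} (h : g ∣ g') :
    constacyclicCode n β g' ≤ constacyclicCode n β g := fun _ hc =>
  Ideal.span_singleton_le_span_singleton.2 (map_dvd (AdjoinRoot.mk (X ^ n - C β)) h) hc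

/-- The code is the kernel of the reduction of words modulo `g`, which is onto a space of dimension
deg g. -/
theorem finrank_constacyclicCode_add {β : F} {g : F[X]} (hn : 0 < n) (hm : g.Monic)
    (hg : g ∣ X ^ n - C β) :
    Module.finrank F (constacyclicCode n β g) + g.natDegree = n := by
  let L : (Fin n → F) →ₗ[F] AdjoinRoot g := (AdjoinRoot.mkₐ g).toLinearMap ∘ₗ wordPoly
  have hker : LinearMap.ker L = constacyclicCode n β g := by
    ext c
    rw [mem_constacyclicCode hg, LinearMap.mem_ker]
    exact AdjoinRoot.mk_eq_zero
  have hle : g.degree ≤ n := by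
    rw [← degree_X_pow_sub_C hn β]
    exact degree_le_of_dvd hg (X_pow_sub_C_ne_zero hn β)
  have hsurj : LinearMap.range L = ⊤ := by
    rw [LinearMap.range_eq_top]
    intro z
    obtain ⟨f, rfl⟩ := AdjoinRoot.mk_surjective z
    refine ⟨fun i => (f %ₘ g).coeff i, ?_⟩
    change AdjoinRoot.mk g (wordPoly _) = _
    rw [wordPoly_coeff ((degree_modByMonic_lt f hm).trans_le hle), AdjoinRoot.mk_eq_mk]
    refine ⟨-(f /ₘ g), ?_⟩
    linear_combination modByMonic_add_div f g
  have := L.finrank_range_add_finrank_ker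
  rw [hsurj, hker, finrank_top, (AdjoinRoot.powerBasis' hm).finrank,
    AdjoinRoot.powerBasis'_dim] at this
  simp only [Module.finrank_fintype_fun_eq_card, Fintype.card_fin] at this
  omega

/-- Reversing one factor turns the pairing of equal indices into a convolution, read off at degree n
- 1. -/
theorem dotProduct_eq_coeff (a b : Fin n → F) (hn : 0 < n) :
    a ⬝ᵥ b = (wordPoly b * reflect (n - 1) (wordPoly a)).coeff (n - 1) := by
  rw [coeff_mul, Finset.Nat.sum_antidiagonal_eq_sum_range_succ_mk, Nat.succ_eq_add_one,
    Nat.sub_add_cancel hn, ← Fin.sum_univ_eq_sum_range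
      (fun k => (wordPoly b).coeff k * (reflect (n - 1) (wordPoly a)).coeff (n - 1 - k)) n,
    dotProduct]
  refine Finset.sum_congr rfl fun i _ => ?_
  rw [coeff_reflect, revAt_le (Nat.sub_le _ _), Nat.sub_sub_self (by omega), coeff_wordPoly,
    coeff_wordPoly, mul_comm]

/-- `f` and `f'` are monic of degree `d`, and each is a multiple of the reciprocal of the other. -/
structure IsReciprocal (d : ℕ) (f f' : F[X]) : Prop where
  monic_left : f.Monic
  monic_right : f'.Monic
  natDegree_left : f.natDegree = d
  natDegree_right : f'.natDegree = d
  exists_eq : ∃ e : F, f = C e * reflect d f'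

theorem IsReciprocal.mul {d₁ d₂ : ℕ} {f₁ f₁' f₂ f₂' : F[X]} (h₁ : IsReciprocal d₁ f₁ f₁')
    (h₂ : IsReciprocal d₂ f₂ f₂') : IsReciprocal (d₁ + d₂) (f₁ * f₂) (f₁' * f₂') := by
  refine ⟨h₁.1.mul h₂.1, h₁.2.mul h₂.2, ?_, ?_, ?_⟩
  · rw [h₁.1.natDegree_mul h₂.1, h₁.3, h₂.3]
  · rw [h₁.2.natDegree_mul h₂.2, h₁.4, h₂.4]
  · obtain ⟨e₁, he₁⟩ := h₁.5
    obtain ⟨e₂, he₂⟩ := h₂.5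
    refine ⟨e₁ * e₂, ?_⟩
    rw [reflect_mul _ _ h₁.4.le h₂.4.le, C_mul]
    conv_lhs => rw [he₁, he₂]
    ring

theorem IsReciprocal.pow {d : ℕ} {f f' : F[X]} (h : IsReciprocal d f f') (k : ℕ) :
    IsReciprocal (k * d) (f ^ k) (f' ^ k) := by
  induction k with
  | zero =>
    simp only [zero_mul, pow_zero]
    exact ⟨monic_one, monic_one, natDegree_one, natDegree_one, 1, by simp⟩
  | succ k ih =>
    rw [pow_succ, pow_succ, add_mul, one_mul]
    exact ih.mul h

/-- The dual of `⟨g⟩` is generated by the reciprocal of the check polynomial. -/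
theorem dualCode_constacyclicCode {β β' : F} {d : ℕ} {g h h' : F[X]} (hn : 0 < n) (hg : g.Monic)
    (hgh : g * h = X ^ n - C β) (hh : IsReciprocal d h h') (hdvd : h' ∣ X ^ n - C β') :
    dualCode (constacyclicCode n β g) = constacyclicCode n β' h' := by
  have hgd : g ∣ X ^ n - C β := hgh ▸ dvd_mul_right g h
  have hdeg : g.natDegree + d = n := by
    rw [← hh.natDegree_left, ← hg.natDegree_mul hh.monic_left, hgh, natDegree_X_pow_sub_C]
  symm
  -- One inclusion is enough, since both sides have dimension deg g.
  apply Submodule.eq_of_le_of_finrank_eq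
  · intro a ha b hb
    rw [mem_constacyclicCode hdvd] at ha
    rw [mem_constacyclicCode hgd] at hb
    by_cases ha0 : a = 0
    · simp [ha0]
    by_cases hb0 : b = 0
    · simp [hb0]
    have hda := natDegree_wordPoly_lt ha0
    have hdb := natDegree_wordPoly_lt hb0
    rw [← wordPoly_eq_zero_iff] at ha0 hb0
    rw [dotProduct_eq_coeff a b hn]
    obtain ⟨u, hu⟩ := ha
    obtain ⟨v, hv⟩ := hb
    obtain ⟨e, he⟩ := hh.exists_eq
    have hu0 : u ≠ 0 := by rintro rfl; simp [hu] at ha0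
    have hv0 : v ≠ 0 := by rintro rfl; simp [hv] at hb0
    have he0 : e ≠ 0 := by
      rintro rfl
      exact hh.monic_left.ne_zero (by simpa using he)
    rw [hu, natDegree_mul hh.monic_right.ne_zero hu0, hh.natDegree_right] at hda
    rw [hv, natDegree_mul hg.ne_zero hv0] at hdb
    have hrefl : reflect (n - 1) (wordPoly a) = reflect d h' * reflect (n - 1 - d) u := by
      rw [hu, ← reflect_mul _ _ hh.natDegree_right.le (by omega)]
      congr 1
      omega
    -- The product is P·(x^n - β) with deg P ≤ n - 2: the part P·x^n starts at degree n and P stops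
    -- before n - 1, so nothing remains at degree n - 1.
    have hprod : C e * (wordPoly b * reflect (n - 1) (wordPoly a)) =
        (v * reflect (n - 1 - d) u) * X ^ n - C β * (v * reflect (n - 1 - d) u) := by
      rw [hrefl, hv]
      calc _ = (g * (C e * reflect d h')) * (v * reflect (n - 1 - d) u) := by ring
        _ = _ := by rw [← he, hgh]; ring
    have hru : (reflect (n - 1 - d) u).natDegree ≤ n - 1 - d :=
      (natDegree_reflect_le).trans (by simp; omega)
    have hw : (v * reflect (n - 1 - d) u).natDegree < n - 1 := by
      have := natDegree_mul_le (p := v) (q := reflect (n - 1 - d) u)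
      omega
    have hcoeff := congrArg (fun f => coeff f (n - 1)) hprod
    simp only [coeff_C_mul, coeff_sub, coeff_mul_X_pow'] at hcoeff
    rw [if_neg (by omega), coeff_eq_zero_of_natDegree_lt hw] at hcoeff
    simpa [he0] using hcoeff
  · have h1 := finrank_constacyclicCode_add hn hg hgd
    have h2 := finrank_constacyclicCode_add hn hh.monic_right hdvd
    have h3 := finrank_add_finrank_dualCode (constacyclicCode n β g)
    rw [hh.natDegree_right] at h2
    omega

theorem coeff_zero_ne_zero_of_dvd {β : F} {g : F[X]} (hn : 0 < n) (hβ : β ≠ 0)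
    (hg : g ∣ X ^ n - C β) : g.coeff 0 ≠ 0 := by
  intro h
  have := X_dvd_iff.1 ((X_dvd_iff.2 h).trans hg)
  simp [coeff_X_pow, hn.ne, hβ] at this

/-- A polynomial of low degree does not lie in the dual code. -/
theorem coeff_notMem_dualCode {β : F} {g f : F[X]} (hg : g ∣ X ^ n - C β)
    (hg0 : g.coeff 0 ≠ 0) (hf0 : f ≠ 0) (hf : f.natDegree + g.natDegree < n) :
    (fun i : Fin n => f.coeff i) ∉ dualCode (constacyclicCode n β g) := by
  intro h
  have hdeg : (X ^ f.natDegree * g).degree < (n : WithBot ℕ) := by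
    refine (degree_le_natDegree).trans_lt ?_
    have := natDegree_mul_le (p := X ^ f.natDegree) (q := g)
    rw [natDegree_X_pow] at this
    exact_mod_cast this.trans_lt hf
  -- The shift of `g` to start at degree deg f meets `f` in that position only; the dot product is
  -- the leading coefficient of `f` times g(0).
  have := h (fun i : Fin n => (X ^ f.natDegree * g).coeff i) (by
    rw [mem_constacyclicCode hg, wordPoly_coeff hdeg]
    exact dvd_mul_left _ _)
  rw [dotProduct, Finset.sum_eq_single (⟨f.natDegree, by omega⟩ : Fin n)] at this
  · simp only [coeff_X_pow_mul', le_refl, if_true, Nat.sub_self] at this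
    exact mul_ne_zero (leadingCoeff_ne_zero.2 hf0) hg0 this
  · intro i _ hi
    have hi' : (i : ℕ) ≠ f.natDegree := fun e => hi (Fin.ext e)
    rcases lt_or_gt_of_ne hi' with hlt | hgt
    · simp [coeff_X_pow_mul', not_le.2 hlt]
    · simp [coeff_eq_zero_of_natDegree_lt hgt]
  · simp

open Classical in
theorem hammingNorm_coeff {f : F[X]} (hf : f.natDegree < n) :
    hammingNorm (fun i : Fin n => f.coeff i) = f.support.card := by
  refine Finset.card_bij (fun i _ => (i : ℕ)) ?_ ?_ ?_
  · intro i hi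
    simpa using hi
  · intro i _ j _ h
    exact Fin.ext h
  · intro k hk
    have hk' : k < n := (le_natDegree_of_mem_supp k hk).trans_lt hf
    exact ⟨⟨k, hk'⟩, by simpa using hk, rfl⟩

-- A word of weight one is a monomial; since `g` is prime to X, dividing it would make `g` a unit.
open Classical in
theorem two_le_hammingNorm {β : F} {g : F[X]} (hg : g ∣ X ^ n - C β)
    (hg0 : g.coeff 0 ≠ 0) (hd : 0 < g.natDegree) {w : Fin n → F}
    (hw : w ∈ constacyclicCode n β g) (hw0 : w ≠ 0) : 2 ≤ hammingNorm w := by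
  by_contra! hlt
  have h1 : hammingNorm w = 1 := by
    have := hammingNorm_pos_iff.2 hw0
    omega
  obtain ⟨i, hi⟩ := Finset.card_eq_one.1 h1
  have hwi : wordPoly w = C (w i) * X ^ (i : ℕ) := by
    rw [wordPoly_apply, Finset.sum_eq_single i (fun j _ hj => ?_) (by simp)]
    have : w j = 0 := by
      by_contra hj0
      have : j ∈ Finset.univ.filter (fun i => w i ≠ 0) := by simp [hj0]
      rw [hi] at this
      exact hj (by simpa using this)
    simp [this]
  have hi0 : w i ≠ 0 := by
    have : i ∈ Finset.univ.filter (fun i => w i ≠ 0) := hi ▸ Finset.mem_singleton_self i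
    simpa using this
  rw [mem_constacyclicCode hg, hwi] at hw
  have hcop : IsCoprime g (X ^ (i : ℕ)) := by
    refine IsCoprime.pow_right (IsCoprime.symm ?_)
    rw [prime_X.coprime_iff_not_dvd, X_dvd_iff]
    exact hg0
  have hunit : IsUnit g :=
    isUnit_of_dvd_unit (hcop.dvd_of_dvd_mul_right hw) (isUnit_C.2 hi0.isUnit)
  exact hd.ne' (natDegree_eq_zero_of_isUnit hunit)

-- With `K₂` the dual of `K₁`, both distance conditions of the CSS construction are the same bound
-- `hd`. The degree condition on the light word `f` keeps it out of the dual. Here `d` is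
-- independent of deg g, so codes that are not AMDS are covered too.
open Classical in
theorem isQuantumCode_constacyclicCode [Fintype F] {β : F} {g f : F[X]} {d : ℕ} (hβ : β ≠ 0)
    (hm : g.Monic) (hg : g ∣ X ^ n - C β)
    (hd : ∀ w ∈ constacyclicCode n β g, w ≠ 0 → d ≤ hammingNorm w)
    (hgf : g ∣ f) (hf0 : f ≠ 0) (hf : f.natDegree + g.natDegree < n) (hfd : f.support.card = d)
    (hdual : dualCode (constacyclicCode n β g) ≤ constacyclicCode n β g) :
    IsQuantumCode (cssCode (constacyclicCode n β g) (dualCode (constacyclicCode n β g)))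
      (n - 2 * g.natDegree) d := by
  have hn : 0 < n := by omega
  have hfn : f.natDegree < n := by omega
  have hle := Submodule.finrank_mono hdual
  have h1 := finrank_constacyclicCode_add hn hm hg
  have h2 := finrank_add_finrank_dualCode (constacyclicCode n β g)
  refine isQuantumCode_cssCode hdual (by omega) hd (by rwa [dualCode_dualCode])
    (w := fun i : Fin n => f.coeff i) ?_
    (coeff_notMem_dualCode hg (coeff_zero_ne_zero_of_dvd hn hβ hg) hf0 hf) ?_
  · rwa [mem_constacyclicCode hg,
      wordPoly_coeff ((natDegree_lt_iff_degree_lt hf0).1 hfn)]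
  · rw [hammingNorm_coeff hfn, hfd]

open Classical in
theorem yieldsQAMDS_constacyclicCode [Fintype F] {β : F} {g f : F[X]} {d : ℕ} (hβ : β ≠ 0)
    (hm : g.Monic) (hg : g ∣ X ^ n - C β) (hgd : g.natDegree = d) (hdn : 2 * d ≤ n)
    (hd : ∀ w ∈ constacyclicCode n β g, w ≠ 0 → d ≤ hammingNorm w)
    (hgf : g ∣ f) (hf0 : f ≠ 0) (hf : f.natDegree + d < n) (hfd : f.support.card = d) :
    YieldsQAMDS (constacyclicCode n β g) d := by
  have hn : 0 < n := by omega
  have hfn : f.natDegree < n := by omega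
  have h1 := finrank_constacyclicCode_add hn hm hg
  have hword := wordPoly_coeff ((natDegree_lt_iff_degree_lt hf0).1 hfn)
  refine ⟨⟨⟨by omega, minDist_eq hd (w := fun i : Fin n => f.coeff i) ?_ ?_ ?_⟩, by omega⟩,
    fun hdual => ⟨?_, by omega⟩⟩
  · rwa [mem_constacyclicCode hg, hword]
  · rwa [Ne, ← wordPoly_eq_zero_iff, hword]
  · rw [hammingNorm_coeff hfn, hfd]
  · subst hgd
    exact isQuantumCode_constacyclicCode hβ hm hg hd hgf hf0 hf hfd hdual

/-- A quadratic generator with a multiple of weight two. -/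
theorem yieldsQAMDS_two [Fintype F] {β : F} {g : F[X]} (hβ : β ≠ 0)
    (hm : g.Monic) (hg : g ∣ X ^ n - C β) (hgd : g.natDegree = 2) {k : ℕ} {e : F} (hk : 0 < k)
    (he : e ≠ 0) (hgf : g ∣ X ^ k + C e) (hkn : k + 2 < n) :
    YieldsQAMDS (constacyclicCode n β g) 2 := by
  classical
  have hn : 0 < n := by omega
  refine yieldsQAMDS_constacyclicCode hβ hm hg hgd (by omega)
    (fun w hw hw0 => two_le_hammingNorm hg (coeff_zero_ne_zero_of_dvd hn hβ hg) (by omega) hw hw0)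
    hgf (X_pow_add_C_ne_zero hk e) (by rwa [natDegree_X_pow_add_C]) ?_
  have := card_support_binomial (R := F) hk.ne' one_ne_zero he
  rwa [C_1, one_mul, pow_zero, mul_one] at this

end Constacyclic

/-! ### Reciprocals of linear and quadratic factors -/

section Reciprocal

variable {F : Type*} [Field F]

theorem isReciprocal_X_sub_C {a : F} (ha : a ≠ 0) : IsReciprocal 1 (X - C a) (X - C a⁻¹) := by
  refine ⟨monic_X_sub_C a, monic_X_sub_C _, natDegree_X_sub_C a, natDegree_X_sub_C _, -a, ?_⟩
  have h : reflect 1 (X : F[X]) = 1 := by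
    simp
  have hc : C a * C a⁻¹ = (1 : F[X]) := by rw [← C_mul, mul_inv_cancel₀ ha, C_1]
  rw [reflect_sub, reflect_C, h, pow_one, C_neg]
  linear_combination -X * hc

theorem isReciprocal_X_sub_one : IsReciprocal 1 (X - 1 : F[X]) (X - 1) := by
  simpa using isReciprocal_X_sub_C (one_ne_zero (α := F))

theorem isReciprocal_X_add_one : IsReciprocal 1 (X + 1 : F[X]) (X + 1) := by
  have := isReciprocal_X_sub_C (neg_ne_zero.2 (one_ne_zero (α := F)))
  rwa [inv_neg, inv_one, C_neg, C_1, sub_neg_eq_add] at this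

theorem monic_quadratic (c b : F) : (X ^ 2 + C c * X + C b).Monic := by
  monicity!

theorem natDegree_quadratic' (c b : F) : (X ^ 2 + C c * X + C b).natDegree = 2 := by
  compute_degree!

theorem isReciprocal_quadratic (c : F) {b : F} (hb : b ≠ 0) :
    IsReciprocal 2 (X ^ 2 + C c * X + C b) (X ^ 2 + C (c * b⁻¹) * X + C b⁻¹) := by
  refine ⟨monic_quadratic _ _, monic_quadratic _ _, natDegree_quadratic' _ _,
    natDegree_quadratic' _ _, b, ?_⟩
  have h2 : reflect 2 (X ^ 2 : F[X]) = 1 := by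
    simp
  have h1 : reflect 2 (X : F[X]) = X := by
    have := reflect_monomial (R := F) 2 1
    rw [pow_one, revAt_le one_le_two] at this
    simpa using this
  have hc : C b * C b⁻¹ = (1 : F[X]) := by rw [← C_mul, mul_inv_cancel₀ hb, C_1]
  rw [reflect_add, reflect_add, reflect_C, reflect_C_mul, h1, h2, C_mul]
  linear_combination -(X ^ 2 + C c * X) * hc

end Reciprocal

/-! ### Factorizations of x^{4p^s} - β and the resulting duals -/

section Families

variable {F : Type*} [Field F] {p s : ℕ} [Fact p.Prime] [CharP F p]

/-- Additivity of Frobenius reduces the factorization at length 4p^s to that of a quartic. -/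
theorem pow_four_sub_C_pow (e : F) :
    (X ^ 4 - C e : F[X]) ^ p ^ s = X ^ (4 * p ^ s) - C (e ^ p ^ s) := by
  rw [sub_pow_char_pow, ← pow_mul, C_pow]

theorem pow_four_sub_one_pow : (X ^ 4 - 1 : F[X]) ^ p ^ s = X ^ (4 * p ^ s) - C 1 := by
  simpa using pow_four_sub_C_pow (p := p) (s := s) (1 : F)

theorem length_pos : 0 < 4 * p ^ s := by
  have := pow_pos (Fact.out : p.Prime).pos s
  omega

theorem two_ne_zero_of_odd (hp2 : Odd p) : (2 : F) ≠ 0 := by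
  intro h
  have := (CharP.cast_eq_zero_iff F p 2).1 (by exact_mod_cast h)
  have h2 := (Nat.prime_dvd_prime_iff_eq (Fact.out : p.Prime) Nat.prime_two).1 this
  subst h2
  exact absurd hp2 (by decide)

theorem linear_factorization {δ : F} (hδ : δ ^ 2 = -1) :
    ((X - 1) * (X + 1) * (X - C δ) * (X + C δ) : F[X]) = X ^ 4 - 1 := by
  have : C δ ^ 2 = (-1 : F[X]) := by rw [← C_pow, hδ, C_neg, C_1]
  linear_combination -(X ^ 2 - 1) * this

theorem linear_factorization_pow {δ : F} (hδ : δ ^ 2 = -1) :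
    ((X - 1) ^ p ^ s * (X + 1) ^ p ^ s * (X - C δ) ^ p ^ s * (X + C δ) ^ p ^ s : F[X]) =
      X ^ (4 * p ^ s) - C 1 := by
  rw [← pow_four_sub_one_pow, ← linear_factorization hδ, mul_pow, mul_pow, mul_pow]

theorem dualCode_codeLin {δ : F} (hδ : δ ^ 2 = -1) {i j k l : ℕ} (hi : i ≤ p ^ s)
    (hj : j ≤ p ^ s) (hk : k ≤ p ^ s) (hl : l ≤ p ^ s) :
    dualCode (codeLin (p ^ s) δ i j k l) =
      codeLin (p ^ s) δ (p ^ s - i) (p ^ s - j) (p ^ s - l) (p ^ s - k) := by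
  have hδ0 : δ ≠ 0 := by rintro rfl; simp at hδ
  -- Inverting roots exchanges δ and -δ, whence the exchange of the last two exponents in the dual.
  have hinv : δ⁻¹ = -δ := inv_eq_of_mul_eq_one_left (by linear_combination -hδ)
  have hr₁ : IsReciprocal 1 (X + C δ) (X - C δ) := by
    have := isReciprocal_X_sub_C (neg_ne_zero.2 hδ0)
    rwa [inv_neg, hinv, neg_neg, C_neg, sub_neg_eq_add] at this
  have hr₂ : IsReciprocal 1 (X - C δ) (X + C δ) := by
    have := isReciprocal_X_sub_C hδ0
    rwa [hinv, C_neg, sub_neg_eq_add] at this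
  refine dualCode_constacyclicCode (h := (X - 1) ^ (p ^ s - i) * (X + 1) ^ (p ^ s - j) *
    (X + C δ) ^ (p ^ s - l) * (X - C δ) ^ (p ^ s - k)) length_pos ?_ ?_
    (((isReciprocal_X_sub_one.pow _).mul (isReciprocal_X_add_one.pow _)).mul (hr₁.pow _)
      |>.mul (hr₂.pow _)) ?_
  · exact (((isReciprocal_X_sub_one.monic_left.pow _).mul
      (isReciprocal_X_add_one.monic_left.pow _)).mul (hr₂.monic_left.pow _)).mul
      (hr₁.monic_left.pow _)
  · rw [← linear_factorization_pow hδ]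
    -- The first four occurrences of `p ^ s` sit in the check polynomial; each rewriting leaves one
    -- further occurrence behind it, so the index goes up by one each time.
    nth_rewrite 5 [← Nat.add_sub_cancel' hi]
    nth_rewrite 6 [← Nat.add_sub_cancel' hj]
    nth_rewrite 7 [← Nat.add_sub_cancel' hk]
    nth_rewrite 8 [← Nat.add_sub_cancel' hl]
    simp only [pow_add]
    ring
  · rw [← linear_factorization_pow hδ]
    exact mul_dvd_mul (mul_dvd_mul (mul_dvd_mul (pow_dvd_pow _ (Nat.sub_le _ _))
      (pow_dvd_pow _ (Nat.sub_le _ _))) (pow_dvd_pow _ (Nat.sub_le _ _)))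
      (pow_dvd_pow _ (Nat.sub_le _ _))

theorem mixed_factorization_pow :
    ((X - 1) ^ p ^ s * (X + 1) ^ p ^ s * (X ^ 2 + 1) ^ p ^ s : F[X]) =
      X ^ (4 * p ^ s) - C 1 := by
  rw [← pow_four_sub_one_pow, ← mul_pow, ← mul_pow]
  ring

theorem isReciprocal_X_sq_add_one : IsReciprocal 2 (X ^ 2 + 1 : F[X]) (X ^ 2 + 1) := by
  simpa using isReciprocal_quadratic (0 : F) one_ne_zero

theorem dualCode_codeMixed {i j k : ℕ} (hi : i ≤ p ^ s) (hj : j ≤ p ^ s) (hk : k ≤ p ^ s) :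
    dualCode (codeMixed F (p ^ s) i j k) =
      codeMixed F (p ^ s) (p ^ s - i) (p ^ s - j) (p ^ s - k) := by
  have hr := fun i j k => ((isReciprocal_X_sub_one (F := F).pow i).mul
    (isReciprocal_X_add_one.pow j)).mul (isReciprocal_X_sq_add_one.pow k)
  refine dualCode_constacyclicCode length_pos (hr i j k).monic_left ?_
    (hr (p ^ s - i) (p ^ s - j) (p ^ s - k)) ?_
  · rw [← mixed_factorization_pow]
    nth_rewrite 4 [← Nat.add_sub_cancel' hi]
    nth_rewrite 5 [← Nat.add_sub_cancel' hj]
    nth_rewrite 6 [← Nat.add_sub_cancel' hk]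
    simp only [pow_add]
    ring
  · rw [← mixed_factorization_pow]
    exact mul_dvd_mul (mul_dvd_mul (pow_dvd_pow _ (Nat.sub_le _ _))
      (pow_dvd_pow _ (Nat.sub_le _ _))) (pow_dvd_pow _ (Nat.sub_le _ _))

theorem quad_factorization_pow (φ : F) :
    ((X ^ 2 - C φ) ^ p ^ s * (X ^ 2 + C φ) ^ p ^ s : F[X]) =
      X ^ (4 * p ^ s) - C (φ ^ (2 * p ^ s)) := by
  rw [pow_mul φ, ← pow_four_sub_C_pow, ← mul_pow, C_pow]
  ring

theorem isReciprocal_X_sq_add_C {φ : F} (hφ : φ ≠ 0) :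
    IsReciprocal 2 (X ^ 2 + C φ) (X ^ 2 + C φ⁻¹) := by
  simpa using isReciprocal_quadratic 0 hφ

theorem isReciprocal_X_sq_sub_C {φ : F} (hφ : φ ≠ 0) :
    IsReciprocal 2 (X ^ 2 - C φ) (X ^ 2 - C φ⁻¹) := by
  simpa [inv_neg, sub_eq_add_neg] using isReciprocal_X_sq_add_C (neg_ne_zero.2 hφ)

theorem dualCode_codeQuad {φ : F} (hφ : φ ≠ 0) {i j : ℕ} (hi : i ≤ p ^ s) (hj : j ≤ p ^ s) :
    dualCode (codeQuad (p ^ s) φ i j) = codeQuad (p ^ s) φ⁻¹ (p ^ s - i) (p ^ s - j) := by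
  have hr := fun i j => ((isReciprocal_X_sq_sub_C hφ).pow i).mul
    ((isReciprocal_X_sq_add_C hφ).pow j)
  refine dualCode_constacyclicCode length_pos (hr i j).monic_left ?_
    (hr (p ^ s - i) (p ^ s - j)) ?_
  · rw [← quad_factorization_pow]
    nth_rewrite 3 [← Nat.add_sub_cancel' hi]
    nth_rewrite 4 [← Nat.add_sub_cancel' hj]
    simp only [pow_add]
    ring
  · rw [← quad_factorization_pow]
    exact mul_dvd_mul (pow_dvd_pow _ (Nat.sub_le _ _)) (pow_dvd_pow _ (Nat.sub_le _ _))

theorem trinom_factorization {c b : F} (hc : c ^ 2 = 2 * b) :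
    ((X ^ 2 + C c * X + C b) * (X ^ 2 - C c * X + C b) : F[X]) = X ^ 4 - C (-b ^ 2) := by
  have : C c ^ 2 = (2 * C b : F[X]) := by rw [← C_pow, hc, C_mul, C_ofNat]
  rw [C_neg, C_pow]
  linear_combination -X ^ 2 * this

theorem trinom_factorization_pow (hp2 : Odd p) {c b : F} (hc : c ^ 2 = 2 * b) :
    ((X ^ 2 + C c * X + C b) ^ p ^ s * (X ^ 2 - C c * X + C b) ^ p ^ s : F[X]) =
      X ^ (4 * p ^ s) - C (-b ^ (2 * p ^ s)) := by
  rw [← mul_pow, trinom_factorization hc, pow_four_sub_C_pow, (hp2.pow).neg_pow, ← pow_mul]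

theorem isReciprocal_quadratic' (c : F) {b : F} (hb : b ≠ 0) :
    IsReciprocal 2 (X ^ 2 - C c * X + C b) (X ^ 2 - C (c * b⁻¹) * X + C b⁻¹) := by
  simpa [sub_eq_add_neg] using isReciprocal_quadratic (-c) hb

theorem dualCode_codeTrinom (hp2 : Odd p) {c b : F} (hb : b ≠ 0) (hc : c ^ 2 = 2 * b) {i j : ℕ}
    (hi : i ≤ p ^ s) (hj : j ≤ p ^ s) :
    dualCode (codeTrinom (p ^ s) c b i j) =
      codeTrinom (p ^ s) (c * b⁻¹) b⁻¹ (p ^ s - i) (p ^ s - j) := by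
  have hr := fun i j => ((isReciprocal_quadratic c hb).pow i).mul
    ((isReciprocal_quadratic' c hb).pow j)
  -- The reciprocal pair satisfies the relation of the family, so its product is again a binomial
  -- quartic.
  have hc' : (c * b⁻¹) ^ 2 = 2 * b⁻¹ := by
    rw [mul_pow, hc]
    field_simp
  refine dualCode_constacyclicCode length_pos (hr i j).monic_left ?_
    (hr (p ^ s - i) (p ^ s - j)) ?_
  · rw [← trinom_factorization_pow hp2 hc]
    nth_rewrite 3 [← Nat.add_sub_cancel' hi]
    nth_rewrite 4 [← Nat.add_sub_cancel' hj]
    simp only [pow_add]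
    ring
  · rw [← trinom_factorization_pow hp2 hc']
    exact mul_dvd_mul (pow_dvd_pow _ (Nat.sub_le _ _)) (pow_dvd_pow _ (Nat.sub_le _ _))

end Families

/-! ### Distance three from pairwise independent check columns -/

section Distance

variable {F : Type*} [Field F] {n : ℕ}

open Classical in
/-- A code whose check matrix has pairwise independent columns has distance at least three. -/
theorem three_le_hammingNorm (hn : 1 < n) {ι : Type*} {A : Fin n → ι → F}
    (hA : ∀ i j, i ≠ j → ∃ a b, A i a * A j b - A i b * A j a ≠ 0) {w : Fin n → F}
    (hw : ∀ a, ∑ k, w k * A k a = 0) (hw0 : w ≠ 0) : 3 ≤ hammingNorm w := by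
  by_contra! hlt
  obtain ⟨i, hi⟩ : ∃ i, w i ≠ 0 := by
    by_contra! h
    exact hw0 (funext h)
  -- The support lies in a pair {i, j}; if it is {i} alone, any other `j` serves, which requires n >
  -- 1.
  obtain ⟨j, hji, hj⟩ : ∃ j, j ≠ i ∧ ∀ k, k ≠ i → k ≠ j → w k = 0 := by
    by_cases h : ∃ j, j ≠ i ∧ w j ≠ 0
    · obtain ⟨j, hji, hj⟩ := h
      refine ⟨j, hji, fun k hki hkj => ?_⟩
      by_contra hk
      have hsub : ({i, j, k} : Finset (Fin n)) ⊆ Finset.univ.filter fun k => w k ≠ 0 := by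
        intro l hl
        simp only [Finset.mem_insert, Finset.mem_singleton] at hl
        rcases hl with rfl | rfl | rfl <;> simpa
      have := Finset.card_le_card hsub
      rw [Finset.card_eq_three.2 ⟨i, j, k, hji.symm, hki.symm, hkj.symm, rfl⟩] at this
      exact absurd this (not_le.2 hlt)
    · push Not at h
      have : Nontrivial (Fin n) := Fin.nontrivial_iff_two_le.2 hn
      obtain ⟨j, hji⟩ := exists_ne i
      exact ⟨j, hji, fun k hki _ => h k hki⟩
  have hsum : ∀ a, w i * A i a + w j * A j a = 0 := fun a => by
    rw [← hw a, ← Finset.sum_pair (f := fun k => w k * A k a) hji.symm]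
    refine Finset.sum_subset (Finset.subset_univ _) fun k _ hk => ?_
    simp only [Finset.mem_insert, Finset.mem_singleton, not_or] at hk
    rw [hj k hk.1 hk.2, zero_mul]
  obtain ⟨a, b, hab⟩ := hA i j hji.symm
  refine mul_ne_zero hi hab ?_
  linear_combination A j b * hsum a - A j a * hsum b

/-- The CSS construction from two check matrices with three rows. -/
theorem exists_isQAMDS_three [Fintype F] (hn : 6 ≤ n) {A B : Fin n → Fin 3 → F}
    (hAB : ∀ a b, ∑ k, A k a * B k b = 0)
    (hA : ∀ i j, i ≠ j → ∃ a b, A i a * A j b - A i b * A j a ≠ 0)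
    (hB : ∀ i j, i ≠ j → ∃ a b, B i a * B j b - B i b * B j a ≠ 0)
    (hA₀ : ∀ t : Fin 3 → F, (∀ k, ∑ a, t a * A k a = 0) → t = 0)
    {i₁ i₂ i₃ : Fin n} (h₁₂ : i₁ ≠ i₂) (h₁₃ : i₁ ≠ i₃) (h₂₃ : i₂ ≠ i₃)
    {e₁ e₂ e₃ : F} (he₁ : e₁ ≠ 0) (he₂ : e₂ ≠ 0) (he₃ : e₃ ≠ 0)
    (he : ∀ a, e₁ * A i₁ a + e₂ * A i₂ a + e₃ * A i₃ a = 0)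
    (hB₀ : ∀ t : Fin 3 → F,
      (∀ k, k ≠ i₁ → k ≠ i₂ → k ≠ i₃ → ∑ a, t a * B k a = 0) → t = 0) :
    ∃ Q : Submodule ℂ (StateSpace F n), IsQAMDS Q (n - 6) 3 := by
  classical
  let U : (Fin n → Fin 3 → F) → Submodule F (Fin n → F) := fun M =>
    Submodule.span F (Set.range fun a k => M k a)
  have hmem : ∀ M w, w ∈ dualCode (U M) ↔ ∀ a, ∑ k, w k * M k a = 0 := by
    intro M w
    refine ⟨fun h a => h _ (Submodule.subset_span ⟨a, rfl⟩), fun h b hb => ?_⟩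
    induction hb using Submodule.span_induction with
    | mem x hx => obtain ⟨a, rfl⟩ := hx; exact h a
    | zero => exact dotProduct_zero w
    | add x y _ _ hx hy => rw [dotProduct_add, hx, hy, add_zero]
    | smul c x _ hx => rw [dotProduct_smul, hx, smul_zero]
  have hrank : ∀ M : Fin n → Fin 3 → F,
      (∀ t : Fin 3 → F, (∀ k, ∑ a, t a * M k a = 0) → t = 0) → Module.finrank F (U M) = 3 := by
    intro M hM
    have hli : LinearIndependent F (fun (a : Fin 3) (k : Fin n) => M k a) := by
      rw [Fintype.linearIndependent_iff]
      intro t ht a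
      refine congrFun (hM t fun k => ?_) a
      simpa using congrFun ht k
    simpa using finrank_span_eq_card hli
  have hrA := hrank A hA₀
  have hrB := hrank B fun t ht => hB₀ t fun k _ _ _ => ht k
  have hdual := finrank_add_finrank_dualCode (U A)
  have hle : U B ≤ dualCode (U A) := by
    refine Submodule.span_le.2 ?_
    rintro _ ⟨b, rfl⟩
    rw [SetLike.mem_coe, hmem]
    intro a
    rw [← hAB a b]
    exact Finset.sum_congr rfl fun k _ => mul_comm _ _
  let w : Fin n → F := Pi.single i₁ e₁ + Pi.single i₂ e₂ + Pi.single i₃ e₃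
  have hw₁ : w i₁ = e₁ := by simp [w, h₁₂, h₁₃]
  have hw₂ : w i₂ = e₂ := by simp [w, h₁₂.symm, h₂₃]
  have hw₃ : w i₃ = e₃ := by simp [w, h₁₃.symm, h₂₃.symm]
  have hw₀ : ∀ k, k ≠ i₁ → k ≠ i₂ → k ≠ i₃ → w k = 0 := by
    intro k h1 h2 h3
    simp [w, h1, h2, h3]
  -- `K₁` is the code checked by `A`, and `K₂` is the row space of `B`, whose dual is checked by
  -- `B`. The word `w` of weight three encodes a linear relation among three columns of `A`.
  refine ⟨cssCode (dualCode (U A)) (U B), isQuantumCode_cssCode hle (by omega) ?_ ?_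
    (w := w) ?_ ?_ ?_, by omega⟩
  · exact fun v hv hv0 => three_le_hammingNorm (by omega) hA ((hmem A v).1 hv) hv0
  · exact fun v hv hv0 => three_le_hammingNorm (by omega) hB ((hmem B v).1 hv) hv0
  · rw [hmem]
    intro a
    have : w ⬝ᵥ (fun k => A k a) = 0 := by
      simp only [w, add_dotProduct, single_dotProduct]
      exact he a
    exact this
  · intro hwU
    obtain ⟨t, ht⟩ := (Submodule.mem_span_range_iff_exists_fun F).1 hwU
    -- A combination of rows of `B` equal to `w` vanishes off the three positions, so it is trivial.
    have ht0 : t = 0 := hB₀ t fun k h1 h2 h3 => by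
      rw [← hw₀ k h1 h2 h3, ← ht]
      simp
    rw [ht0] at ht
    have := congrFun ht i₁
    simp [hw₁, he₁.symm] at this
  · have : (Finset.univ.filter fun k => w k ≠ 0) = {i₁, i₂, i₃} := by
      ext k
      simp only [Finset.mem_filter, Finset.mem_univ, true_and, Finset.mem_insert,
        Finset.mem_singleton]
      constructor
      · intro hk
        by_contra! h
        exact hk (hw₀ k h.1 h.2.1 h.2.2)
      · rintro (rfl | rfl | rfl)
        · rwa [hw₁]
        · rwa [hw₂]
        · rwa [hw₃]
    rw [hammingNorm, this, Finset.card_eq_three]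
    exact ⟨_, _, _, h₁₂, h₁₃, h₂₃, rfl⟩

end Distance

/-! ### Characteristic three: an explicit code of length twelve -/

section TernaryCase

/-- Twelve points of the projective plane over the field with three elements. -/
def planePoints : Fin 12 → Fin 3 → ℤ :=
  ![![1, 0, 0], ![1, 1, 0], ![1, 2, 0], ![1, 0, 1], ![1, 1, 1], ![1, 2, 1],
    ![1, 0, 2], ![1, 1, 2], ![1, 2, 2], ![0, 1, 0], ![0, 1, 1], ![0, 1, 2]]

/-- Twelve points of the projective plane over the field with three elements, orthogonal to
`planePoints`. -/
def planePoints' : Fin 12 → Fin 3 → ℤ :=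
  ![![1, 0, 2], ![0, 2, 2], ![1, 1, 2], ![2, 2, 2], ![1, 0, 0], ![0, 1, 2],
    ![0, 0, 1], ![0, 1, 0], ![1, 2, 1], ![1, 0, 1], ![2, 2, 0], ![1, 2, 2]]

/-- Two point lists are needed: the matrices x xᵀ over all thirteen points of the plane over the
field with three elements sum to zero, so twelve of them leave a nonzero rank one matrix and cannot
be orthogonal to themselves. All conditions are divisibilities by 3 or explicit linear equations. -/
theorem exists_isQAMDS_twelve {F : Type*} [Field F] [Fintype F] [CharP F 3] :
    ∃ Q : Submodule ℂ (StateSpace F 12), IsQAMDS Q (12 - 6) 3 := by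
  have hminor : ∀ M : Fin 12 → Fin 3 → ℤ,
      (∀ i j, i ≠ j → ∃ a b, ¬ (3 : ℤ) ∣ M i a * M j b - M i b * M j a) →
      ∀ i j, i ≠ j → ∃ a b, (M i a : F) * M j b - M i b * M j a ≠ 0 := by
    intro M hM i j hij
    obtain ⟨a, b, hab⟩ := hM i j hij
    refine ⟨a, b, fun h => hab ?_⟩
    refine (CharP.intCast_eq_zero_iff F 3 _).1 ?_
    push_cast
    exact h
  refine exists_isQAMDS_three (A := fun k a => (planePoints k a : F))
    (B := fun k a => (planePoints' k a : F)) (by norm_num) ?_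
    (hminor _ (by decide)) (hminor _ (by decide)) ?_
    (i₁ := 0) (i₂ := 1) (i₃ := 2) (by decide) (by decide) (by decide)
    (one_ne_zero) (one_ne_zero) (one_ne_zero) ?_ ?_
  · intro a b
    have : (3 : ℤ) ∣ ∑ k, planePoints k a * planePoints' k b := by
      revert a b; decide
    have := (CharP.intCast_eq_zero_iff F 3 _).2 this
    exact_mod_cast this
  · intro t ht
    have h0 := ht 0
    have h1 := ht 9
    have h2 := ht 3
    simp [planePoints, Fin.sum_univ_three] at h0 h1 h2
    ext a
    fin_cases a <;> simp_all
  · intro a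
    have : (3 : ℤ) ∣ 1 * planePoints 0 a + 1 * planePoints 1 a + 1 * planePoints 2 a := by
      revert a; decide
    have := (CharP.intCast_eq_zero_iff F 3 _).2 this
    exact_mod_cast this
  · intro t ht
    have h0 := ht 4 (by decide) (by decide) (by decide)
    have h1 := ht 7 (by decide) (by decide) (by decide)
    have h2 := ht 6 (by decide) (by decide) (by decide)
    simp [planePoints', Fin.sum_univ_three] at h0 h1 h2
    ext a
    fin_cases a <;> simp_all

end TernaryCase

/-! ### Characteristic at least five: a grid of 4p points -/

section LargeCharacteristic

variable {F : Type*} [Field F] {p : ℕ} [Fact p.Prime] [CharP F p]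

theorem sum_cast_sq_eq_zero (hp : 5 ≤ p) : ∑ x : Fin p, (x : F) ^ 2 = 0 := by
  have h : ∀ t : ℕ, 6 * ∑ x ∈ Finset.range t, (x : F) ^ 2 = t * (t - 1) * (2 * t - 1) := by
    intro t
    induction t with
    | zero => simp
    | succ t ih =>
      rw [Finset.sum_range_succ, mul_add, ih]
      push_cast
      ring
  have hp0 := h p
  have h6 : (6 : F) ≠ 0 := by
    intro h6
    have := (CharP.cast_eq_zero_iff F p 6).1 (by exact_mod_cast h6)
    have h23 := (Fact.out : p.Prime).dvd_mul.1 (show p ∣ 2 * 3 from this)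
    rcases h23 with h2 | h3
    · exact absurd (Nat.le_of_dvd (by norm_num) h2) (by omega)
    · exact absurd (Nat.le_of_dvd (by norm_num) h3) (by omega)
  rw [CharP.cast_eq_zero F p, zero_mul, zero_mul, Finset.sum_range] at hp0
  exact (mul_eq_zero.1 hp0).resolve_left h6

theorem sum_cast_eq_zero {p : ℕ} [CharP F p] (hp : 5 ≤ p) : ∑ x : Fin p, (x : F) = 0 := by
  have h : ∀ t : ℕ, 2 * ∑ x ∈ Finset.range t, (x : F) = t * (t - 1) := by
    intro t
    induction t with
    | zero => simp
    | succ t ih =>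
      rw [Finset.sum_range_succ, mul_add, ih]
      push_cast
      ring
  have hp0 := h p
  have h2 : (2 : F) ≠ 0 := by
    intro h2
    have := (CharP.cast_eq_zero_iff F p 2).1 (by exact_mod_cast h2)
    exact absurd (Nat.le_of_dvd (by norm_num) this) (by omega)
  rw [CharP.cast_eq_zero F p, zero_mul, Finset.sum_range] at hp0
  exact (mul_eq_zero.1 hp0).resolve_left h2

/-- Writing k = x + p j identifies the positions with a grid; in characteristic p the cast of k is
that of x. -/
theorem sum_fin_four_mul (f : F → F → F) :
    ∑ k : Fin (4 * p), f k ((k / p : ℕ) : F) = ∑ j : Fin 4, ∑ x : Fin p, f x j := by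
  rw [← finProdFinEquiv.sum_comp, Fintype.sum_prod_type]
  refine Finset.sum_congr rfl fun j _ => Finset.sum_congr rfl fun x _ => ?_
  have hp : 0 < p := (Fact.out : p.Prime).pos
  rw [finProdFinEquiv_apply_val, Nat.add_mul_div_left _ _ hp, Nat.div_eq_of_lt x.2, zero_add]
  simp

/-- The points are (1, x, y) with x in the prime field and y = 0, 1, 2, 3, distinct because p > 3.
The rows are orthogonal to each other and to themselves: for fixed y the sums of 1, x and x² over x
all vanish when p ≥ 5. So one matrix plays both roles. -/
theorem exists_isQAMDS_of_five_le [Fintype F] (hp : 5 ≤ p) :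
    ∃ Q : Submodule ℂ (StateSpace F (4 * p)), IsQAMDS Q (4 * p - 6) 3 := by
  have hcast : ∀ {a b : ℕ}, a < p → b < p → (a : F) = b → a = b := fun ha hb h =>
    ((CharP.natCast_eq_natCast F p).1 h).eq_of_lt_of_lt ha hb
  let A : Fin (4 * p) → Fin 3 → F := fun k => ![1, (k : ℕ), ((k / p : ℕ) : F)]
  have hA : ∀ i j, i ≠ j → ∃ a b, A i a * A j b - A i b * A j a ≠ 0 := by
    intro i j hij
    by_cases h : ((i : ℕ) : F) = (j : ℕ)
    · refine ⟨0, 2, ?_⟩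
      have hi : (i : ℕ) / p < 4 := Nat.div_lt_of_lt_mul (by simpa [mul_comm] using i.2)
      have hj : (j : ℕ) / p < 4 := Nat.div_lt_of_lt_mul (by simpa [mul_comm] using j.2)
      intro h'
      have h'' : (((j : ℕ) / p : ℕ) : F) = ((i : ℕ) / p : ℕ) := by
        simpa [A, sub_eq_zero] using h'
      have hdiv := hcast (by omega) (by omega) h''
      have hmod : (i : ℕ) % p = j % p := (CharP.natCast_eq_natCast F p).1 h
      refine hij (Fin.ext ?_)
      rw [← Nat.div_add_mod (i : ℕ) p, ← Nat.div_add_mod (j : ℕ) p, hdiv, hmod]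
    · exact ⟨0, 1, by simpa [A, sub_eq_zero] using Ne.symm h⟩
  have hA₀ : ∀ t : Fin 3 → F, (∀ k : Fin (4 * p), k ≠ ⟨0, by omega⟩ → k ≠ ⟨1, by omega⟩ →
      k ≠ ⟨2, by omega⟩ → ∑ a, t a * A k a = 0) → t = 0 := by
    intro t ht
    -- The points (1,3,0), (1,4,0), (1,0,1) avoid the three chosen positions and span the space.
    have h3 := ht ⟨3, by omega⟩ (by simp) (by simp) (by simp)
    have h4 := ht ⟨4, by omega⟩ (by simp) (by simp) (by simp)
    have h5 := ht ⟨p, by omega⟩ (by simp; omega) (by simp; omega) (by simp; omega)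
    simp only [A, Fin.sum_univ_three, Matrix.cons_val_zero, Matrix.cons_val_one, Matrix.cons_val,
      Nat.div_eq_of_lt (show 3 < p by omega), Nat.div_eq_of_lt (show 4 < p by omega),
      Nat.div_self (show 0 < p by omega), CharP.cast_eq_zero, Nat.cast_zero, Nat.cast_one,
      Nat.cast_ofNat] at h3 h4 h5
    have e1 : t 1 = 0 := by linear_combination h4 - h3
    have e0 : t 0 = 0 := by linear_combination h3 - 3 * e1
    have e2 : t 2 = 0 := by linear_combination h5 - e0
    ext a
    fin_cases a
    · exact e0
    · exact e1
    · exact e2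
  refine exists_isQAMDS_three (by omega) (A := A) (B := A) ?_ hA hA
    (fun t ht => hA₀ t fun k _ _ _ => ht k)
    (i₁ := ⟨0, by omega⟩) (i₂ := ⟨1, by omega⟩) (i₃ := ⟨2, by omega⟩) (by simp) (by simp) (by simp)
    -- The second difference of the collinear points (1,0,0), (1,1,0), (1,2,0) vanishes.
    (e₁ := 1) (e₂ := -2) (e₃ := 1) one_ne_zero ?_ one_ne_zero ?_ hA₀
  · have hA' : ∀ k a, A k a =
        (![fun _ _ => 1, fun x _ => x, fun _ y => y] : Fin 3 → F → F → F) a k ((k / p : ℕ) : F) := by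
      intro k a
      fin_cases a <;> rfl
    intro a b
    simp only [hA']
    rw [sum_fin_four_mul (p := p) fun x y =>
      (![fun _ _ => 1, fun x _ => x, fun _ y => y] : Fin 3 → F → F → F) a x y *
      (![fun _ _ => 1, fun x _ => x, fun _ y => y] : Fin 3 → F → F → F) b x y]
    refine Finset.sum_eq_zero fun j _ => ?_
    fin_cases a <;> fin_cases b <;>
      simp [← Finset.mul_sum, ← Finset.sum_mul, sum_cast_eq_zero hp, ← pow_two,
        sum_cast_sq_eq_zero hp]
  · intro h
    have h2 : ((2 : ℕ) : F) = (0 : ℕ) := by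
      push_cast
      linear_combination -h
    exact absurd (hcast (by omega) (by omega) h2) (by norm_num)
  · intro a
    have h1 : 1 / p = 0 := Nat.div_eq_of_lt (by omega)
    have h2 : 2 / p = 0 := Nat.div_eq_of_lt (by omega)
    fin_cases a
    · simp [A]; norm_num
    · simp [A]
    · simp [A, h1, h2]

/-- Over every finite field of odd characteristic `p` there is a quantum AMDS code of length `4 p`
and distance three. -/
theorem exists_isQAMDS_four_mul_prime [Fintype F] (hp2 : Odd p) :
    ∃ Q : Submodule ℂ (StateSpace F (4 * p)), IsQAMDS Q (4 * p - 6) 3 := by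
  have hp : p.Prime := Fact.out
  rcases lt_or_ge p 5 with h | h
  · have h3 : p = 3 := by
      have := hp.two_le
      interval_cases p
      · exact absurd hp2 (by decide)
      · rfl
      · exact absurd hp2 (by decide)
    subst h3
    exact exists_isQAMDS_twelve
  · exact exists_isQAMDS_of_five_le h

end LargeCharacteristic

/-! ### The AMDS codes of the families and their dual containment -/

section Yields

variable {F : Type*} [Field F] {p s : ℕ} [Fact p.Prime] [CharP F p]

theorem three_le_prime_pow {p s : ℕ} [Fact p.Prime] (hp2 : Odd p) (hs : 0 < s) : 3 ≤ p ^ s := by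
  have h2 := (Fact.out : p.Prime).two_le
  have h3 : 3 ≤ p := by
    rcases hp2 with ⟨k, rfl⟩
    omega
  exact h3.trans (Nat.le_self_pow hs.ne' p)

theorem X_sub_one_mul_X_add_one : ((X - 1) * (X + 1) : F[X]) = X ^ 2 + C (-1) := by
  rw [C_neg, C_1]
  ring

theorem yieldsQAMDS_codeMixed_one_one [Fintype F] (hp2 : Odd p) (hs : 0 < s) :
    YieldsQAMDS (codeMixed F (p ^ s) 1 1 0) 2 := by
  have hN := three_le_prime_pow hp2 hs
  have hg : ((X - 1) ^ 1 * (X + 1) ^ 1 * (X ^ 2 + 1) ^ 0 : F[X]) = X ^ 2 + C (-1) := by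
    rw [pow_one, pow_one, pow_zero, mul_one, X_sub_one_mul_X_add_one]
  rw [codeMixed]
  refine yieldsQAMDS_two (k := 2) (e := -1) one_ne_zero ?_ ?_ ?_ two_pos
    (neg_ne_zero.2 one_ne_zero) hg.dvd (by omega)
  · rw [hg]; exact monic_X_pow_add_C _ two_ne_zero
  · rw [← mixed_factorization_pow]
    exact mul_dvd_mul (mul_dvd_mul (pow_dvd_pow _ (by omega)) (pow_dvd_pow _ (by omega)))
      (pow_dvd_pow _ (by omega))
  · rw [hg, natDegree_X_pow_add_C]

theorem yieldsQAMDS_codeMixed_two [Fintype F] (hp2 : Odd p) (hs : 0 < s) :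
    YieldsQAMDS (codeMixed F (p ^ s) 2 0 0) 2 := by
  have hN := three_le_prime_pow hp2 hs
  have hg : ((X - 1) ^ 2 * (X + 1) ^ 0 * (X ^ 2 + 1) ^ 0 : F[X]) = (X - C 1) ^ 2 := by
    rw [pow_zero, pow_zero, mul_one, mul_one, C_1]
  rw [codeMixed]
  -- The binomial multiple of (x-1)² is x^{p^s} - 1 = (x-1)^{p^s}.
  refine yieldsQAMDS_two (k := p ^ s) (e := -1) one_ne_zero ?_ ?_ ?_ (by omega)
    (neg_ne_zero.2 one_ne_zero) ?_ (by omega)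
  · rw [hg]; exact (monic_X_sub_C 1).pow 2
  · rw [← mixed_factorization_pow]
    exact mul_dvd_mul (mul_dvd_mul (pow_dvd_pow _ (by omega)) (pow_dvd_pow _ (by omega)))
      (pow_dvd_pow _ (by omega))
  · rw [hg, natDegree_pow, natDegree_X_sub_C]
  · have : (X ^ p ^ s + C (-1) : F[X]) = (X - C 1) ^ p ^ s := by
      rw [sub_pow_char_pow, C_neg, C_1, one_pow, sub_eq_add_neg]
    rw [hg, this]
    exact pow_dvd_pow _ (by omega)

theorem codeMixed_le {N i j k i' j' k' : ℕ} (hi : i ≤ i') (hj : j ≤ j') (hk : k ≤ k') :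
    codeMixed F N i' j' k' ≤ codeMixed F N i j k :=
  constacyclicCode_le (mul_dvd_mul (mul_dvd_mul (pow_dvd_pow _ hi) (pow_dvd_pow _ hj))
    (pow_dvd_pow _ hk))

theorem codeLin_le {N i j k l i' j' k' l' : ℕ} (δ : F) (hi : i ≤ i') (hj : j ≤ j') (hk : k ≤ k')
    (hl : l ≤ l') : codeLin N δ i' j' k' l' ≤ codeLin N δ i j k l :=
  constacyclicCode_le (mul_dvd_mul (mul_dvd_mul (mul_dvd_mul (pow_dvd_pow _ hi) (pow_dvd_pow _ hj))
    (pow_dvd_pow _ hk)) (pow_dvd_pow _ hl))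

theorem codeLin_eq_codeMixed (N : ℕ) (δ : F) (i j : ℕ) :
    codeLin N δ i j 0 0 = codeMixed F N i j 0 := by
  simp only [codeLin, codeMixed, pow_zero, mul_one]

theorem dualCode_codeMixed_le {i j : ℕ} (hi : 2 * i ≤ p ^ s) (hj : 2 * j ≤ p ^ s) :
    dualCode (codeMixed F (p ^ s) i j 0) ≤ codeMixed F (p ^ s) i j 0 := by
  rw [dualCode_codeMixed (by omega) (by omega) (Nat.zero_le _)]
  exact codeMixed_le (by omega) (by omega) (by omega)

theorem exists_isQAMDS_two [Fintype F] (hp2 : Odd p) (hs : 0 < s) :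
    ∃ Q : Submodule ℂ (StateSpace F (4 * p ^ s)), IsQAMDS Q (4 * p ^ s - 4) 2 := by
  have hN := three_le_prime_pow hp2 hs
  exact ⟨_, (yieldsQAMDS_codeMixed_one_one hp2 hs).2
    (dualCode_codeMixed_le (by omega) (by omega))⟩

/-- The code ⟨x-1⟩ contains its dual, and its generator is itself a word of weight two. -/
theorem exists_isQuantumCode_two [Fintype F] (hp2 : Odd p) (hs : 0 < s) :
    ∃ Q : Submodule ℂ (StateSpace F (4 * p ^ s)), IsQuantumCode Q (4 * p ^ s - 2) 2 := by
  classical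
  have hN := three_le_prime_pow hp2 hs
  have hg : ((X - 1) ^ 1 * (X + 1) ^ 0 * (X ^ 2 + 1) ^ 0 : F[X]) = X - C 1 := by
    rw [pow_one, pow_zero, pow_zero, mul_one, mul_one, C_1]
  have hdual : dualCode (codeMixed F (p ^ s) 1 0 0) ≤ codeMixed F (p ^ s) 1 0 0 :=
    dualCode_codeMixed_le (by omega) (by omega)
  have hdvd : (X - C 1 : F[X]) ∣ X ^ (4 * p ^ s) - C 1 := by
    rw [← mixed_factorization_pow, mul_assoc, C_1]
    exact (dvd_pow_self _ (by omega)).mul_right _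
  rw [codeMixed, hg] at hdual
  have hcard : (X - C 1 : F[X]).support.card = 2 := by
    have := card_support_binomial (R := F) (one_ne_zero : (1 : ℕ) ≠ 0) one_ne_zero
      (neg_ne_zero.2 one_ne_zero)
    rwa [C_1, one_mul, pow_zero, mul_one, pow_one, C_neg, ← sub_eq_add_neg] at this
  have := isQuantumCode_constacyclicCode (d := 2) one_ne_zero (monic_X_sub_C (1 : F)) hdvd
    (fun w hw hw0 => two_le_hammingNorm hdvd
      (coeff_zero_ne_zero_of_dvd length_pos one_ne_zero hdvd) (by rw [natDegree_X_sub_C]; exact one_pos) hw hw0)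
    dvd_rfl (X_sub_C_ne_zero 1) (by rw [natDegree_X_sub_C]; omega) hcard hdual
  rw [natDegree_X_sub_C] at this
  exact ⟨_, this⟩

theorem yieldsQAMDS_codeQuad [Fintype F] (hp2 : Odd p) (hs : 0 < s) {φ : F} (hφ : φ ≠ 0) :
    YieldsQAMDS (codeQuad (p ^ s) φ 1 0) 2 := by
  have hN := three_le_prime_pow hp2 hs
  have hg : ((X ^ 2 - C φ) ^ 1 * (X ^ 2 + C φ) ^ 0 : F[X]) = X ^ 2 + C (-φ) := by
    rw [pow_one, pow_zero, mul_one, C_neg, sub_eq_add_neg]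
  rw [codeQuad]
  refine yieldsQAMDS_two (k := 2) (e := -φ) (pow_ne_zero _ hφ) ?_ ?_ ?_ two_pos
    (neg_ne_zero.2 hφ) hg.dvd (by omega)
  · rw [hg]; exact monic_X_pow_add_C _ two_ne_zero
  · rw [← quad_factorization_pow]
    exact mul_dvd_mul (pow_dvd_pow _ (by omega)) (pow_dvd_pow _ (by omega))
  · rw [hg, natDegree_X_pow_add_C]

theorem inv_sq_eq_sq {φ : F} (h : φ ^ 4 = 1) : φ⁻¹ ^ 2 = φ ^ 2 := by
  rw [inv_pow]
  exact inv_eq_of_mul_eq_one_left (by linear_combination h)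

/-- Since φ⁻² = φ², the code and its dual have the same modulus, and x²-φ divides x⁴-φ² =
(x²-φ⁻¹)(x²+φ⁻¹). Both of these factors occur in the dual generator because p^s ≥ 2. -/
theorem dualCode_codeQuad_le (hp2 : Odd p) (hs : 0 < s) {φ : F} (hφ : φ ≠ 0) (h : φ ^ 4 = 1) :
    dualCode (codeQuad (p ^ s) φ 1 0) ≤ codeQuad (p ^ s) φ 1 0 := by
  have hN := three_le_prime_pow hp2 hs
  rw [dualCode_codeQuad hφ (by omega) (by omega), codeQuad, codeQuad, pow_mul, inv_sq_eq_sq h,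
    ← pow_mul]
  apply constacyclicCode_le
  rw [pow_one, pow_zero, mul_one]
  calc (X ^ 2 - C φ : F[X]) ∣ (X ^ 2 - C φ) * (X ^ 2 + C φ) := dvd_mul_right _ _
    _ = X ^ 4 - C (φ ^ 2) := by rw [C_pow]; ring
    _ = (X ^ 2 - C φ⁻¹) * (X ^ 2 + C φ⁻¹) := by rw [← inv_sq_eq_sq h, C_pow]; ring
    _ ∣ _ := mul_dvd_mul (dvd_pow_self _ (by omega)) (dvd_pow_self _ (by omega))

theorem yieldsQAMDS_codeTrinom [Fintype F] (hp2 : Odd p) (hs : 0 < s) {c b : F} (hb : b ≠ 0)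
    (hc : c ^ 2 = 2 * b) : YieldsQAMDS (codeTrinom (p ^ s) c b 1 0) 2 := by
  have hN := three_le_prime_pow hp2 hs
  have hg : ((X ^ 2 + C c * X + C b) ^ 1 * (X ^ 2 - C c * X + C b) ^ 0 : F[X]) =
      X ^ 2 + C c * X + C b := by
    rw [pow_one, pow_zero, mul_one]
  rw [codeTrinom]
  -- The binomial multiple is the quartic x⁴ + b².
  refine yieldsQAMDS_two (k := 4) (e := b ^ 2) (neg_ne_zero.2 (pow_ne_zero _ hb)) ?_ ?_ ?_
    (by norm_num) (pow_ne_zero _ hb) ?_ (by omega)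
  · rw [hg]; exact monic_quadratic c b
  · rw [← trinom_factorization_pow hp2 hc]
    exact mul_dvd_mul (pow_dvd_pow _ (by omega)) (pow_dvd_pow _ (by omega))
  · rw [hg, natDegree_quadratic']
  · rw [hg]
    exact ⟨_, by rw [trinom_factorization hc, C_neg, sub_neg_eq_add]⟩

theorem dualCode_codeTrinom_le (hp2 : Odd p) (hs : 0 < s) {c b : F} (hb : b ≠ 0)
    (hc : c ^ 2 = 2 * b) (h : b ^ 4 = 1) :
    dualCode (codeTrinom (p ^ s) c b 1 0) ≤ codeTrinom (p ^ s) c b 1 0 := by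
  have hN := three_le_prime_pow hp2 hs
  have hc' : (c * b⁻¹) ^ 2 = 2 * b⁻¹ := by
    rw [mul_pow, hc]
    field_simp
  rw [dualCode_codeTrinom hp2 hb hc (by omega) (by omega), codeTrinom, codeTrinom, pow_mul,
    inv_sq_eq_sq h, ← pow_mul]
  apply constacyclicCode_le
  rw [pow_one, pow_zero, mul_one]
  calc (X ^ 2 + C c * X + C b : F[X]) ∣ _ := dvd_mul_right _ (X ^ 2 - C c * X + C b)
    _ = X ^ 4 - C (-b ^ 2) := trinom_factorization hc
    _ = _ := by rw [← inv_sq_eq_sq h, ← trinom_factorization hc']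
    _ ∣ _ := mul_dvd_mul (dvd_pow_self _ (by omega)) (dvd_pow_self _ (by omega))

-- A codeword has a double root at 1 and a root at δ, which gives check columns (1, k, δ^k).
-- Proportional columns are equal, so their indices agree modulo p and, δ having order 4, modulo 4;
-- hence modulo the length 4p.
open Classical in
theorem three_le_hammingNorm_codeLin (hp2 : Odd p) {δ : F} (hδ : δ ^ 2 = -1)
    {w : Fin (4 * p ^ 1) → F} (hw : w ∈ codeLin (p ^ 1) δ 2 0 1 0) (hw0 : w ≠ 0) :
    3 ≤ hammingNorm w := by
  have hp : p.Prime := Fact.out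
  have hdvd : (X - C 1) ^ 2 * (X - C δ) ∣ wordPoly w := by
    have h := (mem_constacyclicCode (by
      rw [← linear_factorization_pow hδ]
      exact mul_dvd_mul (mul_dvd_mul (mul_dvd_mul (pow_dvd_pow _ (by simpa using hp.two_le))
        (pow_dvd_pow _ (by omega))) (pow_dvd_pow _ (by simpa using hp.one_le)))
        (pow_dvd_pow _ (by omega)))).1 hw
    simpa using h
  obtain ⟨r, hr⟩ := hdvd
  have h0 : (wordPoly w).eval 1 = 0 := by simp [hr]
  have h1 : (derivative (wordPoly w)).eval 1 = 0 := by simp [hr, derivative_mul, derivative_pow]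
  have h2 : (wordPoly w).eval δ = 0 := by simp [hr]
  simp only [wordPoly_apply, derivative_sum, eval_finsetSum, derivative_C_mul_X_pow, eval_mul,
    eval_C, eval_pow, eval_X, one_pow, mul_one] at h0 h1 h2
  let A : Fin (4 * p ^ 1) → Fin 3 → F := fun k => ![1, (k : ℕ), δ ^ (k : ℕ)]
  refine three_le_hammingNorm (A := A) (by have := hp.pos; rw [pow_one]; omega) ?_ ?_ hw0
  · intro i j hij
    by_cases h : ((i : ℕ) : F) = (j : ℕ)
    · refine ⟨0, 2, fun h' => hij (Fin.ext ?_)⟩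
      have h'' : δ ^ (i : ℕ) = δ ^ (j : ℕ) := by
        simpa [A, sub_eq_zero, eq_comm] using h'
      have hδ0 : δ ≠ 0 := by rintro rfl; simp at hδ
      have hne : (-1 : F) ≠ 1 := fun e => two_ne_zero_of_odd (F := F) hp2 (by linear_combination -e)
      have hord : orderOf (Units.mk0 δ hδ0) = 2 ^ (1 + 1) := by
        refine orderOf_eq_prime_pow (fun e => hne ?_) ?_
        · simpa [Units.ext_iff, hδ] using e
        · rw [Units.ext_iff]
          simp only [Units.val_pow_eq_pow_val, Units.val_mk0, Units.val_one]
          linear_combination (δ ^ 2 - 1) * hδ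
      have hmod4 : (i : ℕ) ≡ j [MOD 2 ^ (1 + 1)] := by
        rw [← hord, ← pow_eq_pow_iff_modEq, Units.ext_iff]
        simpa using h''
      have hmodp : (i : ℕ) ≡ j [MOD p] := (CharP.natCast_eq_natCast F p).1 h
      have hcop : Nat.Coprime (2 ^ (1 + 1)) p :=
        Nat.Coprime.pow_left _ (Nat.coprime_two_left.2 hp2)
      have hmod := (Nat.modEq_and_modEq_iff_modEq_mul hcop).1 ⟨hmod4, hmodp⟩
      exact hmod.eq_of_lt_of_lt (by simpa using i.2) (by simpa using j.2)
    · exact ⟨0, 1, by simpa [A, sub_eq_zero] using Ne.symm h⟩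
  · intro a
    fin_cases a
    · simpa [A] using h0
    · simpa [A] using h1
    · simpa [A] using h2

theorem yieldsQAMDS_codeLin_three [Fintype F] (hp2 : Odd p) {δ : F} (hδ : δ ^ 2 = -1) :
    YieldsQAMDS (codeLin (p ^ 1) δ 2 0 1 0) 3 := by
  classical
  have hN := three_le_prime_pow (p := p) hp2 one_pos
  have h2 := two_ne_zero_of_odd (F := F) hp2
  have hg : ((X - 1) ^ 2 * (X + 1) ^ 0 * (X - C δ) ^ 1 * (X + C δ) ^ 0 : F[X]) =
      (X - C 1) ^ 2 * (X - C δ) := by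
    simp
  have hf : ((X ^ 4 - 1) ^ 2 : F[X]) = C 1 * X ^ 0 + C (-2) * X ^ 4 + C 1 * X ^ 8 := by
    rw [C_1, C_neg, C_ofNat]
    ring
  have hm : ((X - C 1) ^ 2 * (X - C δ) : F[X]).Monic :=
    ((monic_X_sub_C 1).pow 2).mul (monic_X_sub_C δ)
  have hfm : (X ^ 4 - 1 : F[X]).Monic := by
    simpa using monic_X_pow_sub_C (1 : F) (by norm_num : 4 ≠ 0)
  -- This multiple is 1 - 2x⁴ + x⁸, of weight three in odd characteristic. The degree condition 8 +
  -- 3 < 4p is tight at p = 3.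
  refine yieldsQAMDS_constacyclicCode (f := (X ^ 4 - 1) ^ 2) one_ne_zero (hg ▸ hm) ?_ ?_
    (by omega) (fun w hw hw0 => three_le_hammingNorm_codeLin hp2 hδ hw hw0) ?_
    (hfm.pow 2).ne_zero ?_ ?_
  · rw [← linear_factorization_pow hδ]
    exact mul_dvd_mul (mul_dvd_mul (mul_dvd_mul (pow_dvd_pow _ (by omega))
      (pow_dvd_pow _ (by omega))) (pow_dvd_pow _ (by omega))) (pow_dvd_pow _ (by omega))
  · rw [hg, ((monic_X_sub_C 1).pow 2).natDegree_mul (monic_X_sub_C δ), natDegree_pow,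
      natDegree_X_sub_C, natDegree_X_sub_C]
  · rw [← linear_factorization hδ, mul_pow, mul_pow, mul_pow]
    exact mul_dvd_mul (mul_dvd_mul (mul_dvd_mul (pow_dvd_pow _ (by omega))
      (pow_dvd_pow _ (by omega))) (pow_dvd_pow _ (by omega))) (pow_dvd_pow _ (by omega))
  · have : (X ^ 4 - 1 : F[X]).natDegree = 4 := by
      simpa using natDegree_X_pow_sub_C (n := 4) (r := (1 : F))
    rw [natDegree_pow, this]
    omega
  · rw [hf]
    exact card_support_trinomial (by norm_num) (by norm_num) one_ne_zero (neg_ne_zero.2 h2)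
      one_ne_zero

theorem charP_of_card_eq_prime_pow [Fintype F] {p m : ℕ} (hp : p.Prime)
    (hF : Fintype.card F = p ^ m) : CharP F p := by
  obtain ⟨r, hr⟩ := CharP.exists F
  obtain ⟨k, hrp, hk⟩ := FiniteField.card F r
  have hdvd : r ∣ p ^ m := by
    rw [← hF, hk]
    exact dvd_pow_self r k.ne_zero
  rwa [← (Nat.prime_dvd_prime_iff_eq hrp hp).1 (hrp.dvd_of_dvd_pow hdvd)]

end Yields

end QAMDS

end

/-! ### Assembly of the six cases -/

open QAMDS in
theorem theorem4p1 (p m s : ℕ) (hp : p.Prime) (hp2 : Odd p) (hs : 0 < s)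
    {F : Type*} [Field F] [Fintype F] (hF : Fintype.card F = p ^ m) :
    -- I
    (∀ δ : F, δ ^ 2 = -1 →
      (∀ i j k l : ℕ, i ≤ p ^ s → j ≤ p ^ s → k ≤ p ^ s → l ≤ p ^ s →
        dualCode (codeLin (p ^ s) δ i j k l) =
          codeLin (p ^ s) δ (p ^ s - i) (p ^ s - j) (p ^ s - l) (p ^ s - k)) ∧
      YieldsQAMDS (codeLin (p ^ s) δ 1 1 0 0) 2 ∧
      dualCode (codeLin (p ^ s) δ 1 1 0 0) ≤ codeLin (p ^ s) δ 1 1 0 0 ∧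
      YieldsQAMDS (codeLin (p ^ s) δ 2 0 0 0) 2 ∧
      (4 ≤ p ^ s → dualCode (codeLin (p ^ s) δ 2 0 0 0) ≤ codeLin (p ^ s) δ 2 0 0 0) ∧
      ∃ Q : Submodule ℂ (StateSpace F (4 * p ^ s)), IsQAMDS Q (4 * p ^ s - 4) 2) ∧
    -- II
    (∀ δ : F, δ ^ 2 = -1 → s = 1 →
      (∃ Q : Submodule ℂ (StateSpace F (4 * p ^ s)), IsQAMDS Q (4 * p ^ s - 4) 2) ∧
      YieldsQAMDS (codeLin (p ^ s) δ 2 0 1 0) 3 ∧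
      (4 ≤ p ^ s → dualCode (codeLin (p ^ s) δ 2 0 1 0) ≤ codeLin (p ^ s) δ 2 0 1 0) ∧
      ∃ Q : Submodule ℂ (StateSpace F (4 * p ^ s)), IsQAMDS Q (4 * p ^ s - 6) 3) ∧
    -- III
    ((∀ i j k : ℕ, i ≤ p ^ s → j ≤ p ^ s → k ≤ p ^ s →
        dualCode (codeMixed F (p ^ s) i j k) =
          codeMixed F (p ^ s) (p ^ s - i) (p ^ s - j) (p ^ s - k)) ∧
      YieldsQAMDS (codeMixed F (p ^ s) 1 1 0) 2 ∧
      dualCode (codeMixed F (p ^ s) 1 1 0) ≤ codeMixed F (p ^ s) 1 1 0 ∧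
      YieldsQAMDS (codeMixed F (p ^ s) 2 0 0) 2 ∧
      (4 ≤ p ^ s → dualCode (codeMixed F (p ^ s) 2 0 0) ≤ codeMixed F (p ^ s) 2 0 0) ∧
      ∃ Q : Submodule ℂ (StateSpace F (4 * p ^ s)), IsQAMDS Q (4 * p ^ s - 4) 2) ∧
    -- IV
    ((∃ Q : Submodule ℂ (StateSpace F (4 * p ^ s)), IsQAMDS Q (4 * p ^ s - 4) 2) ∧
      (s = 1 →
        ∃ Q : Submodule ℂ (StateSpace F (4 * p ^ s)), IsQAMDS Q (4 * p ^ s - 6) 3)) ∧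
    -- V
    (∀ φ : F, φ ≠ 0 →
      (∀ i j : ℕ, i ≤ p ^ s → j ≤ p ^ s →
        dualCode (codeQuad (p ^ s) φ i j) =
          codeQuad (p ^ s) φ⁻¹ (p ^ s - i) (p ^ s - j)) ∧
      YieldsQAMDS (codeQuad (p ^ s) φ 1 0) 2 ∧
      (φ ^ 4 = 1 → dualCode (codeQuad (p ^ s) φ 1 0) ≤ codeQuad (p ^ s) φ 1 0) ∧
      ∃ Q : Submodule ℂ (StateSpace F (4 * p ^ s)), IsQAMDS Q (4 * p ^ s - 4) 2) ∧
    -- VI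
    (∀ γ a b : F, γ ^ 2 = -2 → a ≠ 0 → b = -a ^ 2 →
      (∀ i j : ℕ, i ≤ p ^ s → j ≤ p ^ s →
        dualCode (codeTrinom (p ^ s) (γ * a) b i j) =
          codeTrinom (p ^ s) (γ * a * b⁻¹) b⁻¹ (p ^ s - i) (p ^ s - j)) ∧
      YieldsQAMDS (codeTrinom (p ^ s) (γ * a) b 1 0) 2 ∧
      (b ^ 4 = 1 →
        dualCode (codeTrinom (p ^ s) (γ * a) b 1 0) ≤ codeTrinom (p ^ s) (γ * a) b 1 0) ∧
      (∃ Q : Submodule ℂ (StateSpace F (4 * p ^ s)), IsQAMDS Q (4 * p ^ s - 4) 2) ∧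
      ∃ Q : Submodule ℂ (StateSpace F (4 * p ^ s)), IsQuantumCode Q (4 * p ^ s - 2) 2) := by
  have : Fact p.Prime := ⟨hp⟩
  have : CharP F p := charP_of_card_eq_prime_pow hp hF
  have hN := three_le_prime_pow (p := p) hp2 hs
  have hQ₂ := exists_isQAMDS_two (F := F) (p := p) hp2 hs
  have hQ₃ : s = 1 →
      ∃ Q : Submodule ℂ (StateSpace F (4 * p ^ s)), IsQAMDS Q (4 * p ^ s - 6) 3 := by
    rintro rfl
    rw [pow_one]
    exact exists_isQAMDS_four_mul_prime hp2
  refine ⟨fun δ hδ => ⟨fun i j k l hi hj hk hl => dualCode_codeLin hδ hi hj hk hl, ?_, ?_, ?_,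
    fun h4 => ?_, hQ₂⟩, fun δ hδ hs1 => ⟨hQ₂, ?_, fun h4 => ?_, hQ₃ hs1⟩,
    ⟨fun i j k hi hj hk => dualCode_codeMixed hi hj hk, yieldsQAMDS_codeMixed_one_one hp2 hs,
      dualCode_codeMixed_le (by omega) (by omega), yieldsQAMDS_codeMixed_two hp2 hs,
      fun h4 => dualCode_codeMixed_le (by omega) (by omega), hQ₂⟩, ⟨hQ₂, hQ₃⟩,
    fun φ hφ => ⟨fun i j hi hj => dualCode_codeQuad hφ hi hj, yieldsQAMDS_codeQuad hp2 hs hφ,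
      dualCode_codeQuad_le hp2 hs hφ, hQ₂⟩, fun γ a b hγ ha hb => ?_⟩
  · rw [codeLin_eq_codeMixed]
    exact yieldsQAMDS_codeMixed_one_one hp2 hs
  · rw [codeLin_eq_codeMixed]
    exact dualCode_codeMixed_le (by omega) (by omega)
  · rw [codeLin_eq_codeMixed]
    exact yieldsQAMDS_codeMixed_two hp2 hs
  · rw [codeLin_eq_codeMixed]
    exact dualCode_codeMixed_le (by omega) (by omega)
  · subst hs1
    exact yieldsQAMDS_codeLin_three hp2 hδ
  · rw [dualCode_codeLin hδ (by omega) (by omega) (by omega) (by omega)]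
    exact codeLin_le δ (by omega) (by omega) (by omega) (by omega)
  · have hb0 : b ≠ 0 := by
      rw [hb]
      exact neg_ne_zero.2 (pow_ne_zero _ ha)
    -- This relation cancels the x² term of the product of the two trinomials.
    have hc : (γ * a) ^ 2 = 2 * b := by
      rw [hb]
      linear_combination a ^ 2 * hγ
    exact ⟨fun i j hi hj => dualCode_codeTrinom hp2 hb0 hc hi hj,
      yieldsQAMDS_codeTrinom hp2 hs hb0 hc, dualCode_codeTrinom_le hp2 hs hb0 hc, hQ₂,
      exists_isQuantumCode_two hp2 hs⟩
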